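/- Let $\mathbb K$ be a field of characteristic zero. For a finite-dimensional $\mathbb Z$-graded vector space $V$ let $\mathcal O(V)=\prod_{n\ge 0}S^n(V^\vee)$ be the algebra of formal power series on $V$ (graded symmetric powers, Koszul signs throughout), and let $I^V:\mathcal O(V)\to\mathcal O(V)\otimes V^\vee$ be the algebraic de Rham operator, whose component along $v\in V$ is the right contraction $\omega\mapsto\omega\llcorner v$. Let $(L,A)$ be an SH Lie pair: $L$ is a finite-dimensional $L_\infty[1]$-algebra, given by a homological vector field $Q_L$ (a degree $1$ derivation of $\mathcal O(L)$ with $Q_L^2=0$; $\lambda_0\neq0$ is allowed), and $j:A\hookrightarrow L$ is a subalgebra, i.e. $A$ is a graded subspace with homological vector field $Q_A$ such that $j^\vee\circ Q_L=Q_A\circ j^\vee$, where $j^\vee:\mathcal O(L)\to\mathcal O(A)$ is the restriction. Put $J=(j^\vee\otimes1)\circ I^L:\mathcal O(L)\to\mathcal O(A)\otimes L^\vee$ and $A^\perp=\ker(j^\vee:L^\vee\to A^\vee)$. The spaces $A^\vee$, $L^\vee$ and $A^\perp\cong(L/A)^\vee$ are $A$-modules with differentials $Q_A+D$, where $D^{A^\vee}(\xi)=I^A(Q_A\xi)$,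 $D^{L^\vee}(\xi)=J(Q_L\xi)$ and $D^{\perp}=D^{L^\vee}|_{A^\perp}$ (which takes values in $\mathcal O(A)\otimes A^\perp$). Let $E$ be an $A$-module, i.e. a graded vector space with an element $D^{A,E}\in(\mathcal O(A)\otimes\operatorname{End}(E))^1$ satisfying $Q_A(D^{A,E})+(D^{A,E})^2=0$. For $F\in\{A^\perp,L^\vee,A^\vee\}$ equip $\mathcal O(A)\otimes F\otimes\operatorname{End}(E)$ with the Chevalley–Eilenberg differential $Q_A+D^F+[D^{A,E},-]$, and write $\mathrm H^\bullet_{\mathrm{CE}}(A,F\otimes\operatorname{End}(E))$ for its cohomology. Then: 1. $$0\to\mathcal O(A)\otimes A^\perp\otimes\operatorname{End}(E)\to\mathcal O(A)\otimes L^\vee\otimes\operatorname{End}(E)\xrightarrow{1\otimes j^\vee\otimes1}\mathcal O(A)\otimes A^\vee\otimes\operatorname{End}(E)\to0$$ is a short exact sequence of cochain complexes; let $\delta:\mathrm H^{1}_{\mathrm{CE}}(A,A^\vee\otimes\operatorname{End}(E))\to\mathrm H^{2}_{\mathrm{CE}}(A,A^\perp\otimes\operatorname{End}(E))$ be its connecting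 map. 2. The element $(I^A\otimes1)(D^{A,E})\in\mathcal O(A)\otimes A^\vee\otimes\operatorname{End}(E)$ is a cocycle of degree $1$. 3. There is an $L$-connection $\nabla=Q_L+D^{L,E}$ on $E$ extending the $A$-module $E$, i.e. some $D^{L,E}\in(\mathcal O(L)\otimes\operatorname{End}(E))^1$ with $(j^\vee\otimes1)(D^{L,E})=D^{A,E}$. For every such $\nabla$, with curvature $R^\nabla=Q_L(D^{L,E})+(D^{L,E})^2$, the element $\alpha^E_\nabla=(J\otimes1)(R^\nabla)$ is a degree $2$ cocycle in $\mathcal O(A)\otimes A^\perp\otimes\operatorname{End}(E)$, and $$\delta\big[(I^A\otimes1)(D^{A,E})\big]=[\alpha^E_\nabla]\in\mathrm H^2_{\mathrm{CE}}(A,A^\perp\otimes\operatorname{End}(E)).$$ In other words, $\delta[(I^A\otimes1)(D^{A,E})]$ is the Atiyah class $[\alpha^E]$, which does not depend on $\nabla$. -/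

import Mathlib

open scoped TensorProduct

namespace SHLie

/-! ## Gradings and Koszul signs -/

/-- Degree subspaces `deg n`, together with the parity operator, which acts on a
homogeneous element `x` of degree `n` as `x ↦ (-1)^n x`. -/
structure Grading (K : Type*) [Field K] (X : Type*) [AddCommGroup X] [Module K X] where
  deg : ℤ → Submodule K X
  sgn : X →ₗ[K] X
  sgn_apply : ∀ (n : ℤ) (x : X), x ∈ deg n → sgn x = ((-1 : K) ^ n) • x

section Gradings

variable {K : Type*} [Field K]

/-- The parity operator of a `ℤ`-graded vector space `V = ⨁ n, 𝒱 n`. -/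
noncomputable def paritySign {V : Type*} [AddCommGroup V] [Module K V] (𝒱 : ℤ → Submodule K V)
    [DirectSum.Decomposition 𝒱] : V →ₗ[K] V :=
  (DirectSum.toModule K ℤ V fun n => ((-1 : K) ^ n) • (𝒱 n).subtype) ∘ₗ
    (DirectSum.decomposeLinearEquiv 𝒱).toLinearMap

theorem paritySign_of_mem {V : Type*} [AddCommGroup V] [Module K V] (𝒱 : ℤ → Submodule K V)
    [DirectSum.Decomposition 𝒱] {n : ℤ} {x : V} (hx : x ∈ 𝒱 n) :
    paritySign 𝒱 x = ((-1 : K) ^ n) • x := by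
  lift x to 𝒱 n using hx
  simp only [paritySign, LinearMap.comp_apply, LinearEquiv.coe_coe,
    DirectSum.decomposeLinearEquiv_apply, DirectSum.decompose_coe]
  erw [DirectSum.toModule_lof]
  rfl

/-- To prove that two linear maps agree on a graded space, check homogeneous elements. -/
theorem linearMap_ext_of_homogeneous {V W : Type*} [AddCommGroup V] [Module K V]
    [AddCommGroup W] [Module K W] (𝒱 : ℤ → Submodule K V) [DirectSum.Decomposition 𝒱]
    {f g : V →ₗ[K] W} (h : ∀ n, ∀ x ∈ 𝒱 n, f x = g x) : f = g := by
  ext x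
  induction x using DirectSum.Decomposition.inductionOn 𝒱 with
  | zero => simp
  | homogeneous x => exact h _ _ x.2
  | add x y hx hy => simp [hx, hy]

/-- The grading of the `ℤ`-graded vector space `V = ⨁ n, 𝒱 n`. -/
noncomputable def Grading.of {V : Type*} [AddCommGroup V] [Module K V] (𝒱 : ℤ → Submodule K V)
    [DirectSum.Decomposition 𝒱] : Grading K V where
  deg := 𝒱
  sgn := paritySign 𝒱
  sgn_apply _ _ hx := paritySign_of_mem 𝒱 hx

/-- The grading of the dual: degree `n` functionals are those supported on `𝒱 (-n)`. -/
noncomputable def Grading.dual {V : Type*} [AddCommGroup V] [Module K V] (𝒱 : ℤ → Submodule K V)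
    [DirectSum.Decomposition 𝒱] : Grading K (Module.Dual K V) where
  deg n :=
    { carrier := {ξ | ∀ m, m ≠ -n → ∀ v ∈ 𝒱 m, ξ v = 0}
      add_mem' := fun ha hb m hm v hv => by
        simp only [Set.mem_ofPred_eq] at ha hb
        simp [ha m hm v hv, hb m hm v hv]
      zero_mem' := fun m hm v hv => by simp
      smul_mem' := fun c x hx m hm v hv => by
        simp only [Set.mem_ofPred_eq] at hx
        simp [hx m hm v hv] }
  sgn := (paritySign 𝒱).dualMap
  sgn_apply n ξ hξ := by
    refine linearMap_ext_of_homogeneous 𝒱 fun m v hv => ?_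
    rw [LinearMap.dualMap_apply, paritySign_of_mem 𝒱 hv, map_smul, LinearMap.smul_apply]
    by_cases hm : m = -n
    · subst hm
      rw [zpow_neg, ← inv_zpow, inv_neg, inv_one]
    · rw [hξ m hm v hv]; simp

/-- The grading of `End(E)`: degree `n` endomorphisms map `ℰ m` to `ℰ (m + n)`. -/
noncomputable def Grading.endo {E : Type*} [AddCommGroup E] [Module K E] (ℰ : ℤ → Submodule K E)
    [DirectSum.Decomposition ℰ] : Grading K (Module.End K E) where
  deg n :=
    { carrier := {φ | ∀ m, ∀ v ∈ ℰ m, φ v ∈ ℰ (m + n)}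
      add_mem' := fun ha hb m v hv => add_mem (ha m v hv) (hb m v hv)
      zero_mem' := fun m v hv => by simp
      smul_mem' := fun c x hx m v hv => Submodule.smul_mem _ c (hx m v hv) }
  sgn := LinearMap.mulLeft K (paritySign ℰ) ∘ₗ LinearMap.mulRight K (paritySign ℰ)
  sgn_apply n φ hφ := by
    refine linearMap_ext_of_homogeneous ℰ fun m v hv => ?_
    have h0 : (-1 : K) ≠ 0 := by simp
    simp only [LinearMap.comp_apply, LinearMap.mulLeft_apply, LinearMap.mulRight_apply,
      Module.End.mul_apply, LinearMap.smul_apply]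
    rw [paritySign_of_mem ℰ hv, map_smul, map_smul, paritySign_of_mem ℰ (hφ m v hv), smul_smul,
      zpow_add₀ h0, ← mul_assoc, ← mul_zpow]
    simp

/-- The total grading of a tensor product. -/
noncomputable def Grading.tensor {X Y : Type*} [AddCommGroup X] [Module K X] [AddCommGroup Y]
    [Module K Y] (g : Grading K X) (h : Grading K Y) : Grading K (X ⊗[K] Y) where
  deg n := ⨆ i : ℤ, Submodule.map₂ (TensorProduct.mk K X Y) (g.deg i) (h.deg (n - i))
  sgn := TensorProduct.map g.sgn h.sgn
  sgn_apply n x hx := by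
    have h0 : (-1 : K) ≠ 0 := by simp
    suffices hle : (⨆ i : ℤ, Submodule.map₂ (TensorProduct.mk K X Y) (g.deg i) (h.deg (n - i))) ≤
        LinearMap.eqLocus (TensorProduct.map g.sgn h.sgn)
          (((-1 : K) ^ n) • (LinearMap.id : X ⊗[K] Y →ₗ[K] X ⊗[K] Y)) from hle hx
    refine iSup_le fun i => Submodule.map₂_le.mpr fun a ha b hb => ?_
    rw [LinearMap.mem_eqLocus]
    simp only [TensorProduct.mk_apply, TensorProduct.map_tmul, LinearMap.smul_apply,
      LinearMap.id_apply]
    rw [g.sgn_apply i a ha, h.sgn_apply _ b hb, TensorProduct.smul_tmul_smul, ← zpow_add₀ h0]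
    congr 2
    ring

/-- The grading induced on a subspace preserved by the parity operator. -/
noncomputable def Grading.sub {X : Type*} [AddCommGroup X] [Module K X] (g : Grading K X)
    (S : Submodule K X) (hS : ∀ x ∈ S, g.sgn x ∈ S) : Grading K S where
  deg n := (g.deg n).comap S.subtype
  sgn := g.sgn.restrict hS
  sgn_apply n x hx := Subtype.ext (g.sgn_apply n x hx)

variable {X : Type*} [AddCommGroup X] [Module K X]

/-- The even part of an element. -/
noncomputable def Grading.even (g : Grading K X) : X →ₗ[K] X :=
  (2⁻¹ : K) • (LinearMap.id + g.sgn)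

/-- The odd part of an element. -/
noncomputable def Grading.odd (g : Grading K X) : X →ₗ[K] X :=
  (2⁻¹ : K) • (LinearMap.id - g.sgn)

/-- The parity decomposition produces the Koszul sign: for `x`, `y` homogeneous of degrees
`m`, `n`, and `B` bilinear, `B x₀ y + B x₁ (sgn y) = (-1)^(m n) B x y`. -/
theorem Grading.koszul_sign [CharZero K] {Y Z : Type*} [AddCommGroup Y] [Module K Y]
    [AddCommGroup Z] [Module K Z] (g : Grading K X) (h : Grading K Y) (B : X →ₗ[K] Y →ₗ[K] Z)
    {m n : ℤ} {x : X} {y : Y} (hx : x ∈ g.deg m) (hy : y ∈ h.deg n) :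
    B (g.even x) y + B (g.odd x) (h.sgn y) = ((-1 : K) ^ (m * n)) • B x y := by
  simp only [Grading.even, Grading.odd, LinearMap.smul_apply, LinearMap.add_apply,
    LinearMap.sub_apply, LinearMap.id_apply, g.sgn_apply m x hx, h.sgn_apply n y hy, map_smul,
    map_add, map_sub]
  rcases Int.even_or_odd m with hm | hm <;> rcases Int.even_or_odd n with hn | hn
  · have : Even (m * n) := hm.mul_right n
    rw [hm.neg_one_zpow, hn.neg_one_zpow, this.neg_one_zpow]; module
  · have : Even (m * n) := hm.mul_right n
    rw [hm.neg_one_zpow, hn.neg_one_zpow, this.neg_one_zpow]; module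
  · have : Even (m * n) := hn.mul_left m
    rw [hm.neg_one_zpow, hn.neg_one_zpow, this.neg_one_zpow]; module
  · have : Odd (m * n) := hm.mul hn
    rw [hm.neg_one_zpow, hn.neg_one_zpow, this.neg_one_zpow]; module

end Gradings

/-! ## The graded symmetric algebra -/

section Sym

variable {K : Type*} [Field K] {W : Type*} [AddCommGroup W] [Module K W]

/-- The defining relations `x ⊙ y = (-1)^(|x||y|) y ⊙ x`. -/
inductive SymRel (g : Grading K W) : TensorAlgebra K W → TensorAlgebra K W → Prop
  | comm (m n : ℤ) (x y : W) (hx : x ∈ g.deg m) (hy : y ∈ g.deg n) :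
      SymRel g (TensorAlgebra.ι K x * TensorAlgebra.ι K y)
        (((-1 : K) ^ (m * n)) • (TensorAlgebra.ι K y * TensorAlgebra.ι K x))

/-- The graded symmetric algebra `S(W)`. -/
def Sym (g : Grading K W) : Type _ := RingQuot (SymRel g)

noncomputable instance (g : Grading K W) : Ring (Sym g) :=
  inferInstanceAs (Ring (RingQuot (SymRel g)))

noncomputable instance (g : Grading K W) : Algebra K (Sym g) :=
  inferInstanceAs (Algebra K (RingQuot (SymRel g)))

namespace Sym

variable (g : Grading K W)

/-- The quotient map from the tensor algebra. -/
noncomputable def mk : TensorAlgebra K W →ₐ[K] Sym g := RingQuot.mkAlgHom K (SymRel g)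

/-- The inclusion of `W` in `S(W)`. -/
noncomputable def ι : W →ₗ[K] Sym g := (mk g).toLinearMap ∘ₗ TensorAlgebra.ι K

theorem ι_comm {m n : ℤ} {x y : W} (hx : x ∈ g.deg m) (hy : y ∈ g.deg n) :
    ι g x * ι g y = ((-1 : K) ^ (m * n)) • (ι g y * ι g x) := by
  have : mk g _ = mk g _ := RingQuot.mkAlgHom_rel K (SymRel.comm m n x y hx hy)
  simpa [ι] using this

variable {g}

/-- The universal property of `S(W)`. -/
noncomputable def lift {B : Type*} [Ring B] [Algebra K B] (f : W →ₗ[K] B)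
    (hf : ∀ (m n : ℤ) (x y : W), x ∈ g.deg m → y ∈ g.deg n →
      f x * f y = ((-1 : K) ^ (m * n)) • (f y * f x)) : Sym g →ₐ[K] B :=
  RingQuot.liftAlgHom K ⟨TensorAlgebra.lift K f, by
    rintro _ _ ⟨m, n, x, y, hx, hy⟩
    simpa using hf m n x y hx hy⟩

@[simp] theorem lift_ι {B : Type*} [Ring B] [Algebra K B] (f : W →ₗ[K] B)
    (hf : ∀ (m n : ℤ) (x y : W), x ∈ g.deg m → y ∈ g.deg n →
      f x * f y = ((-1 : K) ^ (m * n)) • (f y * f x)) (x : W) : lift f hf (ι g x) = f x := by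
  have := RingQuot.liftAlgHom_mkAlgHom_apply K (TensorAlgebra.lift K f) (s := SymRel g) (by
    rintro _ _ ⟨m, n, x, y, hx, hy⟩
    simpa using hf m n x y hx hy) (TensorAlgebra.ι K x)
  rw [TensorAlgebra.lift_ι_apply] at this
  exact this

/-- `S(W)` is generated by `W`. -/
theorem induction {C : Sym g → Prop} (one : C 1) (smul : ∀ (r : K) x, C x → C (r • x))
    (add : ∀ x y, C x → C y → C (x + y)) (ι_mul : ∀ w x, C x → C (ι g w * x)) (x : Sym g) :
    C x := by
  obtain ⟨t, rfl⟩ : ∃ t, mk g t = x := RingQuot.mkAlgHom_surjective K (SymRel g) x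
  suffices h : ∀ y : Sym g, C y → C (mk g t * y) by
    simpa using h 1 one
  induction t using TensorAlgebra.induction with
  | algebraMap r => intro y hy; simpa [Algebra.smul_def] using smul r y hy
  | ι w => intro y hy; exact ι_mul w y hy
  | add a b ha hb => intro y hy; rw [map_add, add_mul]; exact add _ _ (ha y hy) (hb y hy)
  | mul a b ha hb => intro y hy; rw [map_mul, mul_assoc]; exact ha _ (hb y hy)

/-- Functoriality of `S(W)` for linear maps of degree `0`. -/
noncomputable def map {W' : Type*} [AddCommGroup W'] [Module K W'] {g' : Grading K W'}
    (f : W →ₗ[K] W') (hf : ∀ n, ∀ x ∈ g.deg n, f x ∈ g'.deg n) : Sym g →ₐ[K] Sym g' :=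
  lift (ι g' ∘ₗ f) fun m n x y hx hy => ι_comm g' (hf m x hx) (hf n y hy)

@[simp] theorem map_ι {W' : Type*} [AddCommGroup W'] [Module K W'] {g' : Grading K W'}
    (f : W →ₗ[K] W') (hf : ∀ n, ∀ x ∈ g.deg n, f x ∈ g'.deg n) (x : W) :
    map f hf (ι g x) = ι g' (f x) := by
  simp [map]

variable (g)

/-- The parity automorphism `x ↦ (-1)^|x| x` of `S(W)`. -/
noncomputable def sgn : Sym g →ₐ[K] Sym g :=
  map g.sgn fun n x hx => by
    rw [g.sgn_apply n x hx]; exact Submodule.smul_mem _ _ hx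

@[simp] theorem sgn_ι (x : W) : sgn g (ι g x) = ι g (g.sgn x) := map_ι _ _ x

/-- `S^n(W)`. -/
noncomputable def weight (n : ℕ) : Submodule K (Sym g) := (LinearMap.range (ι g)) ^ n

/-- `S^n(W)^d`, the span of the products of `n` homogeneous elements of `W` whose degrees
add up to `d`. -/
noncomputable def bideg (n : ℕ) (d : ℤ) : Submodule K (Sym g) :=
  Submodule.span K {x | ∃ l : List (ℤ × W), l.length = n ∧ (∀ p ∈ l, p.2 ∈ g.deg p.1) ∧
    (l.map Prod.fst).sum = d ∧ x = (l.map fun p => ι g p.2).prod}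

theorem sgn_of_mem_bideg {n : ℕ} {d : ℤ} {x : Sym g} (hx : x ∈ bideg g n d) :
    sgn g x = ((-1 : K) ^ d) • x := by
  have h0 : (-1 : K) ≠ 0 := by simp
  suffices h : bideg g n d ≤ LinearMap.eqLocus (sgn g).toLinearMap
      (((-1 : K) ^ d) • (LinearMap.id : Sym g →ₗ[K] Sym g)) from h hx
  refine Submodule.span_le.mpr ?_
  rintro _ ⟨l, -, hl, rfl, rfl⟩
  clear hx
  rw [SetLike.mem_coe, LinearMap.mem_eqLocus, LinearMap.smul_apply, LinearMap.id_apply,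
    AlgHom.toLinearMap_apply]
  induction l with
  | nil => simp
  | cons p l ih =>
    have ih' := ih fun q hq => hl q (List.mem_cons_of_mem _ hq)
    simp only [List.map_cons, List.prod_cons, List.sum_cons, map_mul, sgn_ι]
    rw [ih', g.sgn_apply _ _ (hl p List.mem_cons_self), zpow_add₀ h0, map_smul,
      smul_mul_smul_comm]

variable {g}

theorem map_mem_weight {W' : Type*} [AddCommGroup W'] [Module K W'] {g' : Grading K W'}
    (f : W →ₗ[K] W') (hf : ∀ n, ∀ x ∈ g.deg n, f x ∈ g'.deg n) {n : ℕ} {x : Sym g}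
    (hx : x ∈ weight g n) : map f hf x ∈ weight g' n := by
  have h : (weight g n).map (map f hf).toLinearMap ≤ weight g' n := by
    rw [weight, Submodule.map_pow]
    refine pow_le_pow_left' ?_ n
    rintro _ ⟨_, ⟨w, rfl⟩, rfl⟩
    exact ⟨f w, by simp⟩
  exact h ⟨x, hx, rfl⟩

/-- Auxiliary operator encoding right contraction with `c`: its first component is left
multiplication by `ξ`, its second component carries the contraction along. -/
noncomputable def contrAux (g : Grading K W) (c : Module.Dual K W) :
    W →ₗ[K] Module.End K (Sym g × Sym g) :=
  LinearMap.mk₂ K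
    (fun ξ p => (ι g ξ * p.1, c (g.even ξ) • p.1 + c (g.odd ξ) • sgn g p.1 + ι g ξ * p.2))
    (fun ξ η p => by ext <;> simp only [map_add, add_mul, add_smul, Prod.fst_add, Prod.snd_add]
                     abel)
    (fun r ξ p => by
      ext <;> simp only [map_smul, smul_mul_assoc, smul_add, smul_smul, smul_eq_mul,
        Prod.smul_fst, Prod.smul_snd])
    (fun ξ p q => by ext <;> simp only [map_add, mul_add, smul_add, Prod.fst_add, Prod.snd_add]
                     abel)
    (fun r ξ p => by
      ext <;> simp only [map_smul, mul_smul_comm, smul_add, Prod.smul_fst, Prod.smul_snd,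
        smul_comm r])

theorem contrAux_apply (c : Module.Dual K W) (ξ : W) (p : Sym g × Sym g) : contrAux g c ξ p =
    (ι g ξ * p.1, c (g.even ξ) • p.1 + c (g.odd ξ) • sgn g p.1 + ι g ξ * p.2) := rfl

theorem contrAux_of_mem [CharZero K] (c : Module.Dual K W) {m : ℤ} {ξ : W} (hξ : ξ ∈ g.deg m)
    (p : Sym g × Sym g) :
    contrAux g c ξ p = (ι g ξ * p.1, c ξ • (if Even m then p.1 else sgn g p.1) + ι g ξ * p.2) := by
  simp only [contrAux, LinearMap.mk₂_apply, Grading.even, Grading.odd, LinearMap.smul_apply,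
    LinearMap.add_apply, LinearMap.sub_apply, LinearMap.id_apply, g.sgn_apply m ξ hξ]
  congr 2
  split_ifs with h
  · rw [h.neg_one_zpow]; simp only [map_smul, map_add, map_sub, smul_eq_mul]; module
  · rw [(Int.not_even_iff_odd.mp h).neg_one_zpow]
    simp only [map_smul, map_add, map_sub, smul_eq_mul]; module

theorem contrAux_comm [CharZero K] (c : Module.Dual K W) (m n : ℤ) (ξ η : W)
    (hξ : ξ ∈ g.deg m) (hη : η ∈ g.deg n) : contrAux g c ξ * contrAux g c η =
      ((-1 : K) ^ (m * n)) • (contrAux g c η * contrAux g c ξ) := by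
  refine LinearMap.ext fun p => ?_
  have hc := ι_comm g hξ hη
  rw [Module.End.mul_apply, LinearMap.smul_apply, Module.End.mul_apply,
    contrAux_of_mem c hξ, contrAux_of_mem c hη, contrAux_of_mem c hξ, contrAux_of_mem c hη]
  have h1 : ι g ξ * (ι g η * p.1) = ((-1 : K) ^ (m * n)) • (ι g η * (ι g ξ * p.1)) := by
    rw [← mul_assoc, hc, smul_mul_assoc, mul_assoc]
  have h2 : ι g ξ * (ι g η * p.2) = ((-1 : K) ^ (m * n)) • (ι g η * (ι g ξ * p.2)) := by
    rw [← mul_assoc, hc, smul_mul_assoc, mul_assoc]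
  ext
  · exact h1
  · simp only [Prod.smul_snd, mul_add, h2, smul_add, map_mul, sgn_ι, g.sgn_apply m ξ hξ,
      g.sgn_apply n η hη]
    rcases Int.even_or_odd m with hm | hm <;> rcases Int.even_or_odd n with hn | hn
    · have h3 : Even (m * n) := hm.mul_right n
      simp only [if_pos hm, if_pos hn, h3.neg_one_zpow, mul_smul_comm]
      module
    · have h3 : Even (m * n) := hm.mul_right n
      simp only [if_pos hm, if_neg (Int.not_even_iff_odd.mpr hn), h3.neg_one_zpow,
        hm.neg_one_zpow, one_smul, mul_smul_comm]
      module
    · have h3 : Even (m * n) := hn.mul_left m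
      simp only [if_pos hn, if_neg (Int.not_even_iff_odd.mpr hm), h3.neg_one_zpow,
        hn.neg_one_zpow, one_smul, mul_smul_comm]
      module
    · have h3 : Odd (m * n) := hm.mul hn
      simp only [if_neg (Int.not_even_iff_odd.mpr hn), if_neg (Int.not_even_iff_odd.mpr hm),
        h3.neg_one_zpow, hm.neg_one_zpow, hn.neg_one_zpow, mul_smul_comm, map_smul, smul_mul_assoc]
      module

/-- Right contraction `ω ↦ ω ⌞ c` on `S(W)` with a linear form `c` on `W`. -/
noncomputable def contr [CharZero K] (g : Grading K W) (c : Module.Dual K W) :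
    Sym g →ₗ[K] Sym g :=
  LinearMap.snd K (Sym g) (Sym g) ∘ₗ
    (LinearMap.applyₗ ((1, 0) : Sym g × Sym g) : Module.End K (Sym g × Sym g) →ₗ[K] _) ∘ₗ
    (lift (contrAux g c) (contrAux_comm c)).toLinearMap

theorem lift_contrAux_fst [CharZero K] (c : Module.Dual K W) (x : Sym g) (p : Sym g × Sym g) :
    (lift (contrAux g c) (contrAux_comm c) x p).1 = x * p.1 := by
  induction x using induction with
  | one => simp
  | smul r x hx => simp [hx]
  | add x y hx hy => simp [hx, hy, add_mul]
  | ι_mul w x hx =>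
    rw [map_mul, Module.End.mul_apply, lift_ι, mul_assoc, ← hx]
    rfl

@[simp] theorem contr_one [CharZero K] (c : Module.Dual K W) : contr g c 1 = 0 := by
  simp [contr]

/-- The recursion for right contraction: for `ξ` homogeneous,
`(ξ ⊙ ω) ⌞ c = c(ξ) (-1)^(|ξ||ω|) ω + ξ ⊙ (ω ⌞ c)`. -/
theorem contr_ι_mul [CharZero K] (c : Module.Dual K W) (ξ : W) (ω : Sym g) :
    contr g c (ι g ξ * ω) =
      c (g.even ξ) • ω + c (g.odd ξ) • sgn g ω + ι g ξ * contr g c ω := by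
  simp only [contr, LinearMap.comp_apply, AlgHom.toLinearMap_apply, map_mul,
    LinearMap.applyₗ_apply_apply, Module.End.mul_apply, lift_ι, LinearMap.snd_apply]
  simp only [contrAux_apply, lift_contrAux_fst, mul_one]

theorem contr_mem_weight [CharZero K] (c : Module.Dual K W) {n : ℕ} {x : Sym g}
    (hx : x ∈ weight g (n + 1)) : contr g c x ∈ weight g n := by
  suffices h : ∀ n, weight g n ≤ (weight g (n - 1)).comap (contr g c) from h _ hx
  clear hx
  intro n
  induction n with
  | zero =>
    intro x hx
    obtain ⟨r, rfl⟩ := by simpa [weight, Submodule.mem_one] using hx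
    simp [Algebra.algebraMap_eq_smul_one]
  | succ n ih =>
    rw [weight, pow_succ']
    refine Submodule.mul_le.mpr ?_
    rintro _ ⟨ξ, rfl⟩ ω hω
    rw [Submodule.mem_comap, contr_ι_mul]
    refine add_mem (add_mem (Submodule.smul_mem _ _ hω) (Submodule.smul_mem _ _ ?_)) ?_
    · exact map_mem_weight _ _ hω
    · cases n with
      | zero =>
        obtain ⟨r, rfl⟩ := by simpa [Submodule.mem_one] using hω
        simp [Algebra.algebraMap_eq_smul_one]
      | succ n =>
        have := ih hω
        change _ ∈ weight g (n + 1)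
        rw [weight, pow_succ']
        exact Submodule.mul_mem_mul ⟨ξ, rfl⟩ this

/-- Contraction is linear in the form. -/
theorem contr_add [CharZero K] (c c' : Module.Dual K W) (x : Sym g) :
    contr g (c + c') x = contr g c x + contr g c' x := by
  induction x using induction with
  | one => simp
  | smul r x hx => simp [hx]
  | add x y hx hy => simp only [map_add, hx, hy]; abel
  | ι_mul w x hx =>
    simp only [contr_ι_mul, hx, LinearMap.add_apply]
    rw [mul_add]; module

theorem contr_smul [CharZero K] (r : K) (c : Module.Dual K W) (x : Sym g) :
    contr g (r • c) x = r • contr g c x := by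
  induction x using induction with
  | one => simp
  | smul s x hx => simp only [map_smul, hx, smul_comm r]
  | add x y hx hy => simp only [map_add, hx, hy, smul_add]
  | ι_mul w x hx =>
    simp only [contr_ι_mul, hx, LinearMap.smul_apply, mul_smul_comm]
    module

/-- Naturality of contraction. -/
theorem map_contr [CharZero K] {W' : Type*} [AddCommGroup W'] [Module K W'] {g' : Grading K W'}
    (f : W →ₗ[K] W') (hf : ∀ n, ∀ x ∈ g.deg n, f x ∈ g'.deg n)
    (hs : ∀ x, f (g.sgn x) = g'.sgn (f x)) (c : Module.Dual K W') (x : Sym g) :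
    map f hf (contr g (c ∘ₗ f) x) = contr g' c (map f hf x) := by
  have hsgn : ∀ y, map f hf (sgn g y) = sgn g' (map f hf y) := by
    intro y
    induction y using induction with
    | one => simp
    | smul r x hx => simp [hx]
    | add x y hx hy => simp [hx, hy]
    | ι_mul w x hx => simp [hx, hs]
  induction x using induction with
  | one => simp
  | smul r x hx => simp [hx]
  | add x y hx hy => simp [hx, hy]
  | ι_mul w x hx =>
    simp [contr_ι_mul, hx, hsgn, Grading.even, Grading.odd, hs]

end Sym

/-! ## The completed graded symmetric algebra -/

/-- The formal completion `∏ n, S^n(W)`, realised as the algebra of those formal power series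
with coefficients in `S(W)` whose `n`th coefficient lies in `S^n(W)`. -/
noncomputable def completedSymSubalgebra (g : Grading K W) : Subalgebra K (PowerSeries (Sym g)) where
  carrier := {f | ∀ n, PowerSeries.coeff n f ∈ Sym.weight g n}
  add_mem' := fun {a b} ha hb n => by
    rw [map_add]; exact add_mem (ha n) (hb n)
  mul_mem' := fun {a b} ha hb n => by
    rw [PowerSeries.coeff_mul]
    refine sum_mem fun p hp => ?_
    rw [← Finset.HasAntidiagonal.mem_antidiagonal.mp hp, Sym.weight, pow_add]
    exact Submodule.mul_mem_mul (ha p.1) (hb p.2)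
  algebraMap_mem' := fun r n => by
    rw [PowerSeries.algebraMap_apply, PowerSeries.coeff_C]
    split_ifs with h
    · subst h
      simp [Sym.weight]
    · exact zero_mem _

/-- The formal completion `∏ n, S^n(W)`. -/
def CSym (g : Grading K W) : Type _ := completedSymSubalgebra g

noncomputable instance (g : Grading K W) : Ring (CSym g) :=
  inferInstanceAs (Ring (completedSymSubalgebra g))

noncomputable instance (g : Grading K W) : Algebra K (CSym g) :=
  inferInstanceAs (Algebra K (completedSymSubalgebra g))

namespace CSym

variable {g : Grading K W}

/-- The component in `S^n(W)`. -/
noncomputable def coeff (n : ℕ) : CSym g →ₗ[K] Sym g where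
  toFun f := PowerSeries.coeff n f.1
  map_add' a b := map_add (PowerSeries.coeff n) a.1 b.1
  map_smul' r a := by
    change PowerSeries.coeff n (r • a.1) = r • PowerSeries.coeff n a.1
    rfl

theorem coeff_mem (n : ℕ) (f : CSym g) : coeff n f ∈ Sym.weight g n := f.2 n

@[ext] theorem ext {f f' : CSym g} (h : ∀ n, coeff n f = coeff n f') : f = f' :=
  Subtype.ext (PowerSeries.ext h)

theorem coeff_one (n : ℕ) : coeff n (1 : CSym g) = if n = 0 then 1 else 0 :=
  PowerSeries.coeff_one n

theorem coeff_mul (n : ℕ) (f f' : CSym g) :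
    coeff n (f * f') = ∑ p ∈ Finset.HasAntidiagonal.antidiagonal n, coeff p.1 f * coeff p.2 f' :=
  PowerSeries.coeff_mul n f.1 f'.1

/-- The element with prescribed components. -/
noncomputable def ofCoeff (a : ℕ → Sym g) (ha : ∀ n, a n ∈ Sym.weight g n) : CSym g :=
  ⟨PowerSeries.mk a, fun n => by rw [PowerSeries.coeff_mk]; exact ha n⟩

@[simp] theorem coeff_ofCoeff (a : ℕ → Sym g) (ha : ∀ n, a n ∈ Sym.weight g n) (n : ℕ) :
    coeff n (ofCoeff a ha) = a n := PowerSeries.coeff_mk n a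

variable (g) in
/-- The inclusion `W = S^1(W) → ∏ n, S^n(W)`. -/
noncomputable def ι : W →ₗ[K] CSym g where
  toFun w := ofCoeff (fun n => if n = 1 then Sym.ι g w else 0) fun n => by
    split_ifs with h
    · subst h; rw [Sym.weight, pow_one]; exact ⟨w, rfl⟩
    · exact zero_mem _
  map_add' a b := by
    ext n; simp only [map_add, coeff_ofCoeff]; split_ifs <;> simp
  map_smul' r a := by
    ext n; simp only [map_smul, coeff_ofCoeff, RingHom.id_apply]; split_ifs <;> simp

/-- Functoriality for linear maps of degree `0`. -/
noncomputable def map {W' : Type*} [AddCommGroup W'] [Module K W'] {g' : Grading K W'}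
    (f : W →ₗ[K] W') (hf : ∀ n, ∀ x ∈ g.deg n, f x ∈ g'.deg n) : CSym g →ₐ[K] CSym g' :=
  AlgHom.ofLinearMap
    { toFun := fun x => ofCoeff (fun n => Sym.map f hf (coeff n x)) fun n =>
        Sym.map_mem_weight f hf (coeff_mem n x)
      map_add' := fun a b => by ext n; simp
      map_smul' := fun r a => by ext n; simp }
    (by ext n; simp only [LinearMap.coe_mk, AddHom.coe_mk, coeff_ofCoeff, coeff_one]
        split_ifs <;> simp)
    (fun a b => by ext n; simp [coeff_mul])

@[simp] theorem coeff_map {W' : Type*} [AddCommGroup W'] [Module K W'] {g' : Grading K W'}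
    (f : W →ₗ[K] W') (hf : ∀ n, ∀ x ∈ g.deg n, f x ∈ g'.deg n) (n : ℕ) (x : CSym g) :
    coeff n (map f hf x) = Sym.map f hf (coeff n x) :=
  coeff_ofCoeff _ (fun n => Sym.map_mem_weight f hf (coeff_mem n x)) n

@[simp] theorem map_ι {W' : Type*} [AddCommGroup W'] [Module K W'] {g' : Grading K W'}
    (f : W →ₗ[K] W') (hf : ∀ n, ∀ x ∈ g.deg n, f x ∈ g'.deg n) (x : W) :
    map f hf (ι g x) = ι g' (f x) := by
  ext n
  simp only [coeff_map, ι, LinearMap.coe_mk, AddHom.coe_mk, coeff_ofCoeff]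
  split_ifs <;> simp

variable (g)

/-- The parity automorphism. -/
noncomputable def sgn : CSym g →ₐ[K] CSym g :=
  map g.sgn fun n x hx => by
    rw [g.sgn_apply n x hx]; exact Submodule.smul_mem _ _ hx

/-- The degree `d` part is `∏ n, S^n(W)^d`. -/
noncomputable def grading : Grading K (CSym g) where
  deg d :=
    { carrier := {f | ∀ n, coeff n f ∈ Sym.bideg g n d}
      add_mem' := fun ha hb n => by rw [map_add]; exact add_mem (ha n) (hb n)
      zero_mem' := fun n => by rw [map_zero]; exact zero_mem _
      smul_mem' := fun r x hx n => by rw [map_smul]; exact Submodule.smul_mem _ _ (hx n) }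
  sgn := (sgn g).toLinearMap
  sgn_apply d f hf := by
    ext n
    rw [AlgHom.toLinearMap_apply, map_smul]
    exact (coeff_map _ _ n f).trans (Sym.sgn_of_mem_bideg g (hf n))

variable {g}

/-- Right contraction with a linear form. -/
noncomputable def contr [CharZero K] (c : Module.Dual K W) : CSym g →ₗ[K] CSym g where
  toFun f := ofCoeff (fun n => Sym.contr g c (coeff (n + 1) f)) fun n =>
    Sym.contr_mem_weight c (coeff_mem (n + 1) f)
  map_add' a b := by ext n; simp
  map_smul' r a := by ext n; simp

@[simp] theorem coeff_contr [CharZero K] (c : Module.Dual K W) (n : ℕ) (f : CSym g) :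
    coeff n (contr c f) = Sym.contr g c (coeff (n + 1) f) :=
  coeff_ofCoeff _ (fun n => Sym.contr_mem_weight c (coeff_mem (n + 1) f)) n

end CSym
end Sym

/-! ## Formal power series on a graded vector space -/

/-- The canonical isomorphism `R ⊗ V^∨ ≃ Hom(V, R)`, `ω ⊗ ξ ↦ (v ↦ ξ(v) ω)`, for `V` finite-dimensional. -/
noncomputable def formEquiv {K : Type*} [Field K] (R : Type*) [AddCommGroup R] [Module K R] (V : Type*)
    [AddCommGroup V] [Module K V] [FiniteDimensional K V] :
    R ⊗[K] Module.Dual K V ≃ₗ[K] V →ₗ[K] R :=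
  TensorProduct.comm K R (Module.Dual K V) ≪≫ₗ dualTensorHomEquiv K V R

@[simp] theorem formEquiv_tmul {K : Type*} [Field K] (R : Type*) [AddCommGroup R] [Module K R] (V : Type*)
    [AddCommGroup V] [Module K V] [FiniteDimensional K V] (r : R) (ξ : Module.Dual K V) (v : V) :
    formEquiv R V (r ⊗ₜ[K] ξ) v = ξ v • r := by
  simp [formEquiv]

section PowerSeries

variable {K : Type*} [Field K] [CharZero K]
variable {V : Type*} [AddCommGroup V] [Module K V] (𝒱 : ℤ → Submodule K V)
  [DirectSum.Decomposition 𝒱]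

/-- The algebra `𝒪(V)` of formal power series on `V`. -/
abbrev O : Type _ := CSym (Grading.dual 𝒱)

/-- Right contraction `ω ↦ (v ↦ ω ⌞ v)`. -/
noncomputable def contraction : O 𝒱 →ₗ[K] V →ₗ[K] O 𝒱 :=
  LinearMap.mk₂ K (fun f v => CSym.contr (Module.Dual.eval K V v) f)
    (fun f f' v => map_add _ f f')
    (fun r f v => map_smul _ r f)
    (fun f v w => by
      ext n; simp only [map_add, CSym.coeff_contr, Sym.contr_add])
    (fun r f v => by
      ext n; simp only [map_smul, CSym.coeff_contr, Sym.contr_smul])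

/-- The algebraic de Rham operator `I^V : 𝒪(V) → 𝒪(V) ⊗ V^∨`, dual to `x ⊗ v ↦ x ⊙ v`:
the component of `I^V(ω)` along `v` is `ω ⌞ v`. -/
noncomputable def deRham [FiniteDimensional K V] : O 𝒱 →ₗ[K] O 𝒱 ⊗[K] Module.Dual K V :=
  (formEquiv (O 𝒱) V).symm.toLinearMap ∘ₗ contraction 𝒱

end PowerSeries

section Pullback

variable {K : Type*} [Field K] {L : Type*} [AddCommGroup L] [Module K L]
  {A : Type*} [AddCommGroup A] [Module K A] {ℒ : ℤ → Submodule K L} [DirectSum.Decomposition ℒ]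
  {𝒜 : ℤ → Submodule K A} [DirectSum.Decomposition 𝒜]

theorem dualMap_mem_deg (j : A →ₗ[K] L) (hj : ∀ n, ∀ a ∈ 𝒜 n, j a ∈ ℒ n) (n : ℤ)
    (ξ : Module.Dual K L) (hξ : ξ ∈ (Grading.dual ℒ).deg n) :
    j.dualMap ξ ∈ (Grading.dual 𝒜).deg n :=
  fun m hm a ha => hξ m hm (j a) (hj m a ha)

theorem dualMap_sgn (j : A →ₗ[K] L) (hj : ∀ n, ∀ a ∈ 𝒜 n, j a ∈ ℒ n) (ξ : Module.Dual K L) :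
    j.dualMap ((Grading.dual ℒ).sgn ξ) = (Grading.dual 𝒜).sgn (j.dualMap ξ) := by
  refine linearMap_ext_of_homogeneous 𝒜 fun n a ha => ?_
  change ξ (paritySign ℒ (j a)) = ξ (j (paritySign 𝒜 a))
  rw [paritySign_of_mem ℒ (hj n a ha), paritySign_of_mem 𝒜 ha, map_smul, map_smul, map_smul]

/-- The pullback `j^∨ : 𝒪(L) → 𝒪(A)` along a linear map `j : A → L` of degree `0`. -/
noncomputable def pullback (j : A →ₗ[K] L) (hj : ∀ n, ∀ a ∈ 𝒜 n, j a ∈ ℒ n) : O ℒ →ₐ[K] O 𝒜 :=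
  CSym.map j.dualMap (dualMap_mem_deg j hj)

theorem pullback_contraction [CharZero K] (j : A →ₗ[K] L) (hj : ∀ n, ∀ a ∈ 𝒜 n, j a ∈ ℒ n)
    (f : O ℒ) (a : A) :
    pullback j hj (contraction ℒ f (j a)) = contraction 𝒜 (pullback j hj f) a := by
  ext n
  have h : CSym.coeff n (pullback j hj (contraction ℒ f (j a))) =
      Sym.map j.dualMap (dualMap_mem_deg j hj)
        (Sym.contr _ (Module.Dual.eval K A a ∘ₗ j.dualMap) (CSym.coeff (n + 1) f)) := by
    rw [pullback, CSym.coeff_map]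
    exact congrArg _ (CSym.coeff_contr _ n f)
  rw [h, Sym.map_contr j.dualMap (dualMap_mem_deg j hj) (dualMap_sgn j hj)]
  refine Eq.trans ?_ (CSym.coeff_contr _ n _).symm
  rw [pullback, CSym.coeff_map]

end Pullback

/-! ## SH Lie algebras, SH Lie pairs -/

section SHLiePairs

variable {K : Type*} [Field K]

/-- An SH Lie algebra (`L_∞[1]`-algebra) structure on the graded vector space `L = ⨁ n, ℒ n`,
given by its homological vector field: a derivation `Q` of `𝒪(L)` of degree `1` with `Q² = 0`.
No condition is imposed on the constant part of `Q`, i.e. `λ₀` may be nonzero. -/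
structure SHLieAlgebra {L : Type*} [AddCommGroup L] [Module K L] (ℒ : ℤ → Submodule K L)
    [DirectSum.Decomposition ℒ] where
  Q : O ℒ →ₗ[K] O ℒ
  degree_one : ∀ (n : ℤ) (ω : O ℒ), ω ∈ (CSym.grading _).deg n → Q ω ∈ (CSym.grading _).deg (n + 1)
  leibniz : ∀ (n : ℤ) (ω η : O ℒ), ω ∈ (CSym.grading _).deg n →
    Q (ω * η) = Q ω * η + ((-1 : K) ^ n) • (ω * Q η)
  square_zero : ∀ ω : O ℒ, Q (Q ω) = 0

/-- An SH Lie pair `(L, A)`: SH Lie algebras `L` and `A` and an inclusion `j : A → L` of graded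
vector spaces that makes `A` a subalgebra of `L`, i.e. `j^∨ ∘ Q_L = Q_A ∘ j^∨`. -/
structure SHLiePair {L A : Type*} [AddCommGroup L] [Module K L] [AddCommGroup A] [Module K A]
    (ℒ : ℤ → Submodule K L) [DirectSum.Decomposition ℒ]
    (𝒜 : ℤ → Submodule K A) [DirectSum.Decomposition 𝒜] where
  big : SHLieAlgebra ℒ
  small : SHLieAlgebra 𝒜
  j : A →ₗ[K] L
  j_injective : Function.Injective j
  j_degree_zero : ∀ (n : ℤ) (a : A), a ∈ 𝒜 n → j a ∈ ℒ n
  subalgebra : ∀ ω : O ℒ, pullback j j_degree_zero (big.Q ω) = small.Q (pullback j j_degree_zero ω)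

end SHLiePairs

/-! ## Connections and modules -/

section Connections

variable {K : Type*} [Field K] {L : Type*} [AddCommGroup L] [Module K L]
  {ℒ : ℤ → Submodule K L} [DirectSum.Decomposition ℒ]

/-- The operator `Q + D` on `𝒪(L) ⊗ F`, i.e. `ω ⊗ f ↦ Q(ω) ⊗ f + (-1)^|ω| ω ⊙ D(f)`, for a
linear map `D : F → 𝒪(L) ⊗ F`. -/
noncomputable def connection {F : Type*} [AddCommGroup F] [Module K F] (Q : O ℒ →ₗ[K] O ℒ)
    (D : F →ₗ[K] O ℒ ⊗[K] F) : O ℒ ⊗[K] F →ₗ[K] O ℒ ⊗[K] F :=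
  Q.rTensor F + TensorProduct.lift
    ((LinearMap.lcomp K (O ℒ ⊗[K] F) D) ∘ₗ
      (Algebra.lsmul K K (O ℒ ⊗[K] F)).toLinearMap ∘ₗ (CSym.grading (Grading.dual ℒ)).sgn)

theorem connection_tmul {F : Type*} [AddCommGroup F] [Module K F] (Q : O ℒ →ₗ[K] O ℒ)
    (D : F →ₗ[K] O ℒ ⊗[K] F) {n : ℤ} {ω : O ℒ} (hω : ω ∈ (CSym.grading _).deg n) (f : F) :
    connection Q D (ω ⊗ₜ[K] f) = Q ω ⊗ₜ[K] f + ((-1 : K) ^ n) • (ω • D f) := by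
  simp [connection, (CSym.grading (Grading.dual ℒ)).sgn_apply n ω hω]

/-- Left multiplication by `f ∈ F`, moved past the forms:
`η ⊗ e ↦ (-1)^(|f||η|) η ⊗ (f ⊗ e)`. -/
noncomputable def insertLeft {F E : Type*} [AddCommGroup F] [Module K F] [AddCommGroup E]
    [Module K E] (gF : Grading K F) : F →ₗ[K] O ℒ ⊗[K] E →ₗ[K] O ℒ ⊗[K] (F ⊗[K] E) :=
  LinearMap.lTensorHom (O ℒ) ∘ₗ TensorProduct.mk K F E ∘ₗ gF.even +
    (LinearMap.lcomp K _ ((CSym.grading (Grading.dual ℒ)).sgn.rTensor E)) ∘ₗ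
      LinearMap.lTensorHom (O ℒ) ∘ₗ TensorProduct.mk K F E ∘ₗ gF.odd

theorem insertLeft_tmul [CharZero K] {F E : Type*} [AddCommGroup F] [Module K F] [AddCommGroup E]
    [Module K E] (gF : Grading K F) {m n : ℤ} {f : F} {η : O ℒ} (hf : f ∈ gF.deg m)
    (hη : η ∈ (CSym.grading _).deg n) (e : E) :
    insertLeft gF f (η ⊗ₜ[K] e) = ((-1 : K) ^ (m * n)) • (η ⊗ₜ[K] (f ⊗ₜ[K] e)) := by
  have := gF.koszul_sign (CSym.grading (Grading.dual ℒ))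
    ((TensorProduct.mk K (O ℒ) (F ⊗[K] E)).flip ∘ₗ (TensorProduct.mk K F E).flip e) hf hη
  simpa [insertLeft] using this

/-- The structure map of a tensor product of connections,
`f ⊗ e ↦ D_F(f) ⊗ e + (-1)^|f| f ⊗ D_E(e)`. -/
noncomputable def tensorD {F E : Type*} [AddCommGroup F] [Module K F] [AddCommGroup E] [Module K E]
    (gF : Grading K F) (DF : F →ₗ[K] O ℒ ⊗[K] F) (DE : E →ₗ[K] O ℒ ⊗[K] E) :
    F ⊗[K] E →ₗ[K] O ℒ ⊗[K] (F ⊗[K] E) :=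
  (TensorProduct.assoc K (O ℒ) F E).toLinearMap ∘ₗ DF.rTensor E +
    TensorProduct.lift ((LinearMap.lcomp K _ DE) ∘ₗ insertLeft gF ∘ₗ gF.sgn)

variable {E : Type*} [AddCommGroup E] [Module K E] (ℰ : ℤ → Submodule K E)
  [DirectSum.Decomposition ℰ]

/-- The graded associative product of `𝒪(L) ⊗ End(E)`,
`(ω ⊗ φ) ∘ (η ⊗ ψ) = (-1)^(|φ||η|) (ω ⊙ η) ⊗ φψ`. The products on the right-hand side are those
of the ungraded tensor product of algebras. -/
noncomputable def gradedMul (x y : O ℒ ⊗[K] Module.End K E) : O ℒ ⊗[K] Module.End K E :=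
  (Grading.endo ℰ).even.lTensor (O ℒ) x * y +
    (Grading.endo ℰ).odd.lTensor (O ℒ) x *
      (CSym.grading (Grading.dual ℒ)).sgn.rTensor (Module.End K E) y

theorem gradedMul_tmul [CharZero K] {m n : ℤ} {φ ψ : Module.End K E} {ω η : O ℒ}
    (hφ : φ ∈ (Grading.endo ℰ).deg m) (hη : η ∈ (CSym.grading _).deg n) :
    gradedMul ℰ (ω ⊗ₜ[K] φ) (η ⊗ₜ[K] ψ) =
      ((-1 : K) ^ (m * n)) • ((ω * η) ⊗ₜ[K] (φ * ψ)) := by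
  have := (Grading.endo ℰ).koszul_sign (CSym.grading (Grading.dual ℒ))
    ((TensorProduct.mk K (O ℒ) (Module.End K E)).flip ∘ₗ LinearMap.mulRight K ψ |>.compl₂
      (LinearMap.mulLeft K ω)) hφ hη
  simpa [gradedMul] using this

/-- The graded commutator `[ψ, φ] = ψφ - (-1)^(|ψ||φ|) φψ` on `End(E)`, as a linear map in `ψ`. -/
noncomputable def gradedCommutator (φ : Module.End K E) : Module.End K E →ₗ[K] Module.End K E :=
  LinearMap.mulRight K φ - (LinearMap.mulLeft K ((Grading.endo ℰ).even φ) +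
    LinearMap.mulLeft K ((Grading.endo ℰ).odd φ) ∘ₗ (Grading.endo ℰ).sgn)

theorem gradedCommutator_apply [CharZero K] {m n : ℤ} {φ ψ : Module.End K E}
    (hφ : φ ∈ (Grading.endo ℰ).deg m) (hψ : ψ ∈ (Grading.endo ℰ).deg n) :
    gradedCommutator ℰ φ ψ = ψ * φ - ((-1 : K) ^ (m * n)) • (φ * ψ) := by
  have := (Grading.endo ℰ).koszul_sign (Grading.endo ℰ) (LinearMap.mul K (Module.End K E)) hφ hψ
  simpa [gradedCommutator] using this

/-- The structure map `φ ↦ [D, φ]` of the connection induced on `End(E)` by the element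
`D` of `𝒪(L) ⊗ End(E)`; if `D = ∑ η ⊗ ψ` it is `φ ↦ ∑ η ⊗ [ψ, φ]`. -/
noncomputable def endD (D : O ℒ ⊗[K] Module.End K E) :
    Module.End K E →ₗ[K] O ℒ ⊗[K] Module.End K E where
  toFun φ := (gradedCommutator ℰ φ).lTensor (O ℒ) D
  map_add' φ φ' := by
    rw [← LinearMap.add_apply, ← LinearMap.lTensor_add]
    congr 2
    ext1 ψ
    simp only [gradedCommutator, map_add, LinearMap.sub_apply, LinearMap.add_apply,
      LinearMap.mulRight_apply, LinearMap.mulLeft_apply, LinearMap.comp_apply, mul_add, add_mul]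
    abel
  map_smul' r φ := by
    rw [RingHom.id_apply, ← LinearMap.smul_apply, ← LinearMap.lTensor_smul]
    congr 2
    ext1 ψ
    simp only [gradedCommutator, map_smul, LinearMap.sub_apply, LinearMap.add_apply,
      LinearMap.mulRight_apply, LinearMap.mulLeft_apply, LinearMap.comp_apply, mul_smul_comm,
      smul_mul_assoc, LinearMap.smul_apply, smul_sub, smul_add]

/-- The curvature `R = Q(D) + D ∘ D` of the connection `Q + D`. -/
noncomputable def curvature (Q : O ℒ →ₗ[K] O ℒ) (D : O ℒ ⊗[K] Module.End K E) :
    O ℒ ⊗[K] Module.End K E :=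
  Q.rTensor (Module.End K E) D + gradedMul ℰ D D

/-- A connection on the graded vector space `E`, given by its connection form
`D ∈ (𝒪(L) ⊗ End(E))^1`; the connection itself is `∇ = Q + D`. -/
structure ConnectionForm (ℒ : ℤ → Submodule K L) [DirectSum.Decomposition ℒ]
    (ℰ : ℤ → Submodule K E) [DirectSum.Decomposition ℰ] where
  D : O ℒ ⊗[K] Module.End K E
  degree_one : D ∈ ((CSym.grading (Grading.dual ℒ)).tensor (Grading.endo ℰ)).deg 1

/-- A module structure on `E`: a flat connection. -/
structure SHLieModule (S : SHLieAlgebra ℒ) (ℰ : ℤ → Submodule K E)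
    [DirectSum.Decomposition ℰ] extends ConnectionForm ℒ ℰ where
  flat : curvature ℰ S.Q D = 0

end Connections

/-! ## The coadjoint modules of an SH Lie pair -/

theorem lTensor_subtype_injective {K : Type*} [Field K] (R : Type*) [AddCommGroup R] [Module K R]
    {X : Type*} [AddCommGroup X] [Module K X] (S : Submodule K X) :
    Function.Injective (S.subtype.lTensor R) :=
  Module.Flat.lTensor_preserves_injective_linearMap _ S.injective_subtype

theorem mem_range_lTensor_of_map_eq_zero {K : Type*} [Field K] (R : Type*) [AddCommGroup R]
    [Module K R] {X Y : Type*} [AddCommGroup X] [Module K X] [AddCommGroup Y] [Module K Y]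
    (f : X →ₗ[K] Y) (z : R ⊗[K] X) (hz : f.lTensor R z = 0) :
    z ∈ LinearMap.range ((LinearMap.ker f).subtype.lTensor R) :=
  (Module.Flat.lTensor_exact R (LinearMap.exact_subtype_ker_map f) z).mp hz

namespace SHLiePair

variable {K : Type*} [Field K] [CharZero K]
  {L A : Type*} [AddCommGroup L] [Module K L] [FiniteDimensional K L]
  [AddCommGroup A] [Module K A] [FiniteDimensional K A]
  {ℒ : ℤ → Submodule K L} [DirectSum.Decomposition ℒ]
  {𝒜 : ℤ → Submodule K A} [DirectSum.Decomposition 𝒜]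
  (P : SHLiePair ℒ 𝒜)

/-- The restriction `j^∨ : 𝒪(L) → 𝒪(A)`. -/
noncomputable def res : O ℒ →ₐ[K] O 𝒜 := pullback P.j P.j_degree_zero

/-- The operator `J = (j^∨ ⊗ 1) ∘ I^L : 𝒪(L) → 𝒪(A) ⊗ L^∨`. -/
noncomputable def J : O ℒ →ₗ[K] O 𝒜 ⊗[K] Module.Dual K L :=
  P.res.toLinearMap.rTensor (Module.Dual K L) ∘ₗ deRham ℒ

/-- `(1 ⊗ j^∨) ∘ J = I^A ∘ j^∨`. -/
theorem lTensor_J (ω : O ℒ) : P.j.dualMap.lTensor (O 𝒜) (P.J ω) = deRham 𝒜 (P.res ω) := by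
  apply (formEquiv (O 𝒜) A).injective
  ext1 a
  have h1 : ∀ x : O ℒ ⊗[K] Module.Dual K L, formEquiv (O 𝒜) A (P.j.dualMap.lTensor (O 𝒜)
      (P.res.toLinearMap.rTensor (Module.Dual K L) x)) a = P.res (formEquiv (O ℒ) L x (P.j a)) := by
    intro x
    induction x with
    | zero => simp
    | tmul r ξ => simp
    | add x y hx hy => simp only [map_add, LinearMap.add_apply, hx, hy]
  rw [J, LinearMap.comp_apply, h1]
  simp only [deRham, LinearMap.comp_apply, LinearEquiv.coe_coe, LinearEquiv.apply_symm_apply]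
  exact pullback_contraction P.j P.j_degree_zero ω a

/-- The coadjoint `A`-module structure on `A^∨`: `D^{A^∨}(ξ) = I^A(Q_A(ξ))`. Its component along
`a` is `Q_A(ξ) ⌞ a`, which collects the functions `ξ(λ_{k+1}(-, …, -, a))`. -/
noncomputable def coadjointD : Module.Dual K A →ₗ[K] O 𝒜 ⊗[K] Module.Dual K A :=
  deRham 𝒜 ∘ₗ P.small.Q ∘ₗ CSym.ι (Grading.dual 𝒜)

/-- The dual of the natural `A`-module structure on `L`: `D^{L^∨}(ξ) = J(Q_L(ξ))`. Its
component along `l` is the restriction to `A` of `Q_L(ξ) ⌞ l`, which collects the functions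
`ξ(λ_{k+1}(-, …, -, l))` on `A`. -/
noncomputable def ambientD : Module.Dual K L →ₗ[K] O 𝒜 ⊗[K] Module.Dual K L :=
  P.J ∘ₗ P.big.Q ∘ₗ CSym.ι (Grading.dual ℒ)

/-- The component of `D^{L^∨}(ξ)` along `l`. -/
theorem formEquiv_ambientD (ξ : Module.Dual K L) (l : L) :
    formEquiv (O 𝒜) L (P.ambientD ξ) l =
      P.res (contraction ℒ (P.big.Q (CSym.ι (Grading.dual ℒ) ξ)) l) := by
  have h1 : ∀ x : O ℒ ⊗[K] Module.Dual K L,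
      formEquiv (O 𝒜) L (P.res.toLinearMap.rTensor (Module.Dual K L) x) l =
        P.res (formEquiv (O ℒ) L x l) := by
    intro x
    induction x with
    | zero => simp
    | tmul r ξ => simp
    | add x y hx hy => simp only [map_add, LinearMap.add_apply, hx, hy]
  rw [ambientD, LinearMap.comp_apply, LinearMap.comp_apply, J, LinearMap.comp_apply, h1]
  simp only [deRham, LinearMap.comp_apply, LinearEquiv.coe_coe, LinearEquiv.apply_symm_apply]

/-- The annihilator `A^⊥ = ker (j^∨ : L^∨ → A^∨)`, i.e. the dual of `L/A`. -/
noncomputable def perp : Submodule K (Module.Dual K L) := LinearMap.ker P.j.dualMap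

/-- The grading of `A^⊥`. -/
noncomputable def perpGrading : Grading K P.perp :=
  (Grading.dual ℒ).sub P.perp fun ξ hξ => by
    change P.j.dualMap _ = 0
    rw [dualMap_sgn P.j P.j_degree_zero, show P.j.dualMap ξ = 0 from hξ, map_zero]

theorem ambientD_perp (ξ : P.perp) :
    P.ambientD ξ ∈ LinearMap.range (P.perp.subtype.lTensor (O 𝒜)) := by
  have hξ : P.j.dualMap (ξ : Module.Dual K L) = 0 := ξ.2
  have h0 : P.res (CSym.ι _ (ξ : Module.Dual K L)) = 0 := by
    rw [res, pullback, CSym.map_ι, hξ, map_zero]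
  have h1 : P.res (P.big.Q (CSym.ι _ (ξ : Module.Dual K L))) = 0 :=
    (P.subalgebra _).trans ((congrArg P.small.Q h0).trans (map_zero P.small.Q))
  have h2 := P.lTensor_J (P.big.Q (CSym.ι _ (ξ : Module.Dual K L)))
  rw [h1, map_zero] at h2
  exact mem_range_lTensor_of_map_eq_zero (O 𝒜) P.j.dualMap _ h2

/-- The `A`-module structure on `A^⊥`: `D^⊥(ξ) = J(Q_L(ξ))`, which lies in `𝒪(A) ⊗ A^⊥`. -/
noncomputable def perpD : P.perp →ₗ[K] O 𝒜 ⊗[K] P.perp :=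
  (LinearEquiv.ofInjective _ (lTensor_subtype_injective (O 𝒜) P.perp)).symm.toLinearMap ∘ₗ
    (P.ambientD ∘ₗ P.perp.subtype).codRestrict _ P.ambientD_perp

theorem lTensor_perpD (ξ : P.perp) :
    P.perp.subtype.lTensor (O 𝒜) (P.perpD ξ) = P.ambientD ξ := by
  rw [perpD, LinearMap.comp_apply, LinearEquiv.coe_coe]
  exact congrArg Subtype.val ((LinearEquiv.ofInjective _ (lTensor_subtype_injective (O 𝒜) P.perp)).apply_symm_apply
    ((P.ambientD ∘ₗ P.perp.subtype).codRestrict _ P.ambientD_perp ξ))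

end SHLiePair

/-! ## Cochain complexes, cohomology and the connecting map -/

section Cohomology

variable {K : Type*} [Field K]

/-- A graded space with an operator `d`. -/
structure Cochains (K : Type*) [Field K] (X : Type*) [AddCommGroup X] [Module K X] where
  deg : ℤ → Submodule K X
  d : X →ₗ[K] X

namespace Cochains

variable {X Y Z : Type*} [AddCommGroup X] [Module K X] [AddCommGroup Y] [Module K Y]
  [AddCommGroup Z] [Module K Z]

/-- `C` is a cochain complex: `d` has degree `1` and square zero. -/
structure IsComplex (C : Cochains K X) : Prop where
  d_mem : ∀ (n : ℤ) (x : X), x ∈ C.deg n → C.d x ∈ C.deg (n + 1)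
  d_d : ∀ (n : ℤ) (x : X), x ∈ C.deg n → C.d (C.d x) = 0

/-- The cocycles of degree `n`. -/
def cocycles (C : Cochains K X) (n : ℤ) : Submodule K X := C.deg n ⊓ LinearMap.ker C.d

/-- The coboundaries of degree `n`. -/
def coboundaries (C : Cochains K X) (n : ℤ) : Submodule K X := (C.deg (n - 1)).map C.d

/-- The cohomology of degree `n`. -/
abbrev H (C : Cochains K X) (n : ℤ) : Type _ :=
  C.cocycles n ⧸ (C.coboundaries n).comap (C.cocycles n).subtype

/-- The cohomology class of a cocycle. -/
def cls (C : Cochains K X) (n : ℤ) (x : X) (hx : x ∈ C.cocycles n) : C.H n :=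
  Submodule.Quotient.mk ⟨x, hx⟩

/-- `0 → C₁ → C₂ → C₃ → 0` is a short exact sequence of cochain complexes. -/
structure ShortExact (C₁ : Cochains K X) (C₂ : Cochains K Y) (C₃ : Cochains K Z)
    (i : X →ₗ[K] Y) (p : Y →ₗ[K] Z) : Prop where
  complex₁ : C₁.IsComplex
  complex₂ : C₂.IsComplex
  complex₃ : C₃.IsComplex
  i_mem : ∀ (n : ℤ) (x : X), x ∈ C₁.deg n → i x ∈ C₂.deg n
  p_mem : ∀ (n : ℤ) (y : Y), y ∈ C₂.deg n → p y ∈ C₃.deg n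
  i_d : ∀ (n : ℤ) (x : X), x ∈ C₁.deg n → i (C₁.d x) = C₂.d (i x)
  p_d : ∀ (n : ℤ) (y : Y), y ∈ C₂.deg n → p (C₂.d y) = C₃.d (p y)
  injective : ∀ (n : ℤ) (x : X), x ∈ C₁.deg n → i x = 0 → x = 0
  p_i : ∀ (n : ℤ) (x : X), x ∈ C₁.deg n → p (i x) = 0
  exact : ∀ (n : ℤ) (y : Y), y ∈ C₂.deg n → p y = 0 → ∃ x ∈ C₁.deg n, i x = y
  surjective : ∀ (n : ℤ) (z : Z), z ∈ C₃.deg n → ∃ y ∈ C₂.deg n, p y = z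

namespace ShortExact

variable {C₁ : Cochains K X} {C₂ : Cochains K Y} {C₃ : Cochains K Z}
  {i : X →ₗ[K] Y} {p : Y →ₗ[K] Z}

/-- Every cocycle `z` of `C₃` has a lift `y` along `p`, and `d y = i x` for a cocycle `x`. -/
theorem exists_lift (h : ShortExact C₁ C₂ C₃ i p) {n : ℤ} {z : Z} (hz : z ∈ C₃.cocycles n) :
    ∃ x ∈ C₁.cocycles (n + 1), ∃ y ∈ C₂.deg n, p y = z ∧ i x = C₂.d y := by
  obtain ⟨y, hy, rfl⟩ := h.surjective n z hz.1
  have hd := h.complex₂.d_mem n y hy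
  obtain ⟨x, hx, hxy⟩ := h.exact (n + 1) (C₂.d y) hd (by
    rw [h.p_d n y hy]; exact hz.2)
  refine ⟨x, ⟨hx, ?_⟩, y, hy, rfl, hxy⟩
  refine h.injective (n + 1 + 1) _ (h.complex₁.d_mem _ x hx) ?_
  rw [h.i_d _ x hx, hxy, h.complex₂.d_d n y hy]

/-- The class of `x` depends only on the class of `z`. -/
theorem lift_unique (h : ShortExact C₁ C₂ C₃ i p) {n : ℤ} {x : X} {y : Y}
    (hx : x ∈ C₁.deg (n + 1)) (hy : y ∈ C₂.deg n) (hp : p y ∈ C₃.coboundaries n)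
    (hxy : i x = C₂.d y) : x ∈ C₁.coboundaries (n + 1) := by
  obtain ⟨w, hw, hwy⟩ := hp
  obtain ⟨v, hv, rfl⟩ := h.surjective (n - 1) w hw
  have hdv := h.complex₂.d_mem _ v hv
  rw [sub_add_cancel] at hdv
  obtain ⟨u, hu, hu'⟩ := h.exact n (y - C₂.d v) (sub_mem hy hdv) (by
    rw [map_sub, h.p_d _ v hv, hwy, sub_self])
  refine ⟨u, by simpa using hu, ?_⟩
  rw [← sub_eq_zero]
  refine h.injective (n + 1) _ (sub_mem (h.complex₁.d_mem n u hu) hx) ?_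
  rw [map_sub, h.i_d n u hu, hu', map_sub, h.complex₂.d_d _ v hv, hxy, sub_zero, sub_self]

theorem cls_eq (h : ShortExact C₁ C₂ C₃ i p) {n : ℤ} {x x' : X} {y y' : Y}
    (hx : x ∈ C₁.cocycles (n + 1)) (hx' : x' ∈ C₁.cocycles (n + 1)) (hy : y ∈ C₂.deg n)
    (hy' : y' ∈ C₂.deg n) (hp : p y - p y' ∈ C₃.coboundaries n) (hxy : i x = C₂.d y)
    (hxy' : i x' = C₂.d y') : C₁.cls (n + 1) x hx = C₁.cls (n + 1) x' hx' := by
  refine (Submodule.Quotient.eq _).mpr ?_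
  have hsub : i (x - x') = C₂.d (y - y') := by rw [map_sub, map_sub, hxy, hxy']
  exact h.lift_unique (sub_mem hx.1 hx'.1) (sub_mem hy hy') (by rwa [map_sub]) hsub

/-- The connecting map on cocycles: `z ↦ [x]`, where `p y = z` and `i x = d y`. -/
noncomputable def deltaAux (h : ShortExact C₁ C₂ C₃ i p) (n : ℤ) :
    C₃.cocycles n →ₗ[K] C₁.H (n + 1) where
  toFun z := C₁.cls (n + 1) (h.exists_lift z.2).choose (h.exists_lift z.2).choose_spec.1
  map_add' z z' := by
    obtain ⟨hx, y, hy, hz, hxy⟩ := (h.exists_lift z.2).choose_spec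
    obtain ⟨hx', y', hy', hz', hxy'⟩ := (h.exists_lift z'.2).choose_spec
    obtain ⟨hx'', y'', hy'', hz'', hxy''⟩ := (h.exists_lift (z + z').2).choose_spec
    refine h.cls_eq hx'' (add_mem hx hx') hy'' (add_mem hy hy') ?_ hxy'' ?_
    · rw [map_add, hz, hz', hz'', Submodule.coe_add, sub_self]; exact zero_mem _
    · rw [map_add, map_add, hxy, hxy']
  map_smul' r z := by
    obtain ⟨hx, y, hy, hz, hxy⟩ := (h.exists_lift z.2).choose_spec
    obtain ⟨hx'', y'', hy'', hz'', hxy''⟩ := (h.exists_lift (r • z).2).choose_spec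
    refine h.cls_eq hx'' (Submodule.smul_mem _ r hx) hy'' (Submodule.smul_mem _ r hy) ?_ hxy'' ?_
    · rw [map_smul, hz, hz'', Submodule.coe_smul, sub_self]; exact zero_mem _
    · rw [map_smul, map_smul, hxy]

/-- The connecting map `δ : H^n(C₃) → H^{n+1}(C₁)` of the long exact sequence. -/
noncomputable def delta (h : ShortExact C₁ C₂ C₃ i p) (n : ℤ) : C₃.H n →ₗ[K] C₁.H (n + 1) :=
  Submodule.liftQ _ (h.deltaAux n) (by
    intro z hz
    obtain ⟨hx, y, hy, hz', hxy⟩ := (h.exists_lift z.2).choose_spec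
    refine (Submodule.Quotient.mk_eq_zero _).mpr ?_
    refine h.lift_unique hx.1 hy ?_ hxy
    rw [hz']; exact hz)

/-- `δ[z] = [x]` whenever `p y = z` and `i x = d y`. -/
theorem delta_cls (h : ShortExact C₁ C₂ C₃ i p) {n : ℤ} {x : X} {y : Y} {z : Z}
    (hz : z ∈ C₃.cocycles n) (hx : x ∈ C₁.cocycles (n + 1)) (hy : y ∈ C₂.deg n) (hp : p y = z)
    (hxy : i x = C₂.d y) : h.delta n (C₃.cls n z hz) = C₁.cls (n + 1) x hx := by
  obtain ⟨hx', y', hy', hz', hxy'⟩ := (h.exists_lift hz).choose_spec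
  refine h.cls_eq hx' hx hy' hy ?_ hxy' hxy
  rw [hz', hp, sub_self]; exact zero_mem _

end ShortExact
end Cochains
end Cohomology

/-! ## The Atiyah class -/

namespace SHLiePair

variable {K : Type*} [Field K] [CharZero K]
  {L A E : Type*} [AddCommGroup L] [Module K L] [FiniteDimensional K L]
  [AddCommGroup A] [Module K A] [FiniteDimensional K A] [AddCommGroup E] [Module K E]
  {ℒ : ℤ → Submodule K L} [DirectSum.Decomposition ℒ]
  {𝒜 : ℤ → Submodule K A} [DirectSum.Decomposition 𝒜]
  {ℰ : ℤ → Submodule K E} [DirectSum.Decomposition ℰ]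
  (P : SHLiePair ℒ 𝒜) (M : SHLieModule P.small ℰ)

/-- The Chevalley–Eilenberg complex `𝒪(A) ⊗ F ⊗ End(E)` of the tensor product of an `A`-module `F`
with `End(E)`. -/
noncomputable def ceComplex {F : Type*} [AddCommGroup F] [Module K F] (gF : Grading K F)
    (DF : F →ₗ[K] O 𝒜 ⊗[K] F) : Cochains K (O 𝒜 ⊗[K] (F ⊗[K] Module.End K E)) where
  deg := ((CSym.grading (Grading.dual 𝒜)).tensor (gF.tensor (Grading.endo ℰ))).deg
  d := connection P.small.Q (tensorD gF DF (endD ℰ M.D))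

/-- The complex `𝒪(A) ⊗ A^⊥ ⊗ End(E)`. -/
noncomputable def perpComplex : Cochains K (O 𝒜 ⊗[K] (P.perp ⊗[K] Module.End K E)) :=
  P.ceComplex M P.perpGrading P.perpD

/-- The complex `𝒪(A) ⊗ L^∨ ⊗ End(E)`. -/
noncomputable def ambientComplex :
    Cochains K (O 𝒜 ⊗[K] (Module.Dual K L ⊗[K] Module.End K E)) :=
  P.ceComplex M (Grading.dual ℒ) P.ambientD

/-- The complex `𝒪(A) ⊗ A^∨ ⊗ End(E)`. -/
noncomputable def coadjointComplex :
    Cochains K (O 𝒜 ⊗[K] (Module.Dual K A ⊗[K] Module.End K E)) :=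
  P.ceComplex M (Grading.dual 𝒜) P.coadjointD

variable (E) in
/-- The inclusion `𝒪(A) ⊗ A^⊥ ⊗ End(E) → 𝒪(A) ⊗ L^∨ ⊗ End(E)`. -/
noncomputable def incl : O 𝒜 ⊗[K] (P.perp ⊗[K] Module.End K E) →ₗ[K]
    O 𝒜 ⊗[K] (Module.Dual K L ⊗[K] Module.End K E) :=
  (P.perp.subtype.rTensor (Module.End K E)).lTensor (O 𝒜)

variable (E) in
/-- The projection `1 ⊗ j^∨ ⊗ 1 : 𝒪(A) ⊗ L^∨ ⊗ End(E) → 𝒪(A) ⊗ A^∨ ⊗ End(E)`. -/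
noncomputable def proj : O 𝒜 ⊗[K] (Module.Dual K L ⊗[K] Module.End K E) →ₗ[K]
    O 𝒜 ⊗[K] (Module.Dual K A ⊗[K] Module.End K E) :=
  (P.j.dualMap.rTensor (Module.End K E)).lTensor (O 𝒜)

/-- The element `(I^A ⊗ 1)(D^{A,E})` of `𝒪(A) ⊗ A^∨ ⊗ End(E)`. -/
noncomputable def deRhamForm : O 𝒜 ⊗[K] (Module.Dual K A ⊗[K] Module.End K E) :=
  TensorProduct.assoc K _ _ _ ((deRham 𝒜).rTensor (Module.End K E) M.D)

/-- The `L`-connection `∇` on `E` extends the `A`-module `E`. -/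
def Extends (N : ConnectionForm ℒ ℰ) : Prop :=
  P.res.toLinearMap.rTensor (Module.End K E) N.D = M.D

/-- The element `(J ⊗ 1)(R^∇)` of `𝒪(A) ⊗ L^∨ ⊗ End(E)`. -/
noncomputable def curvatureForm (N : ConnectionForm ℒ ℰ) :
    O 𝒜 ⊗[K] (Module.Dual K L ⊗[K] Module.End K E) :=
  TensorProduct.assoc K _ _ _ (P.J.rTensor (Module.End K E) (curvature ℰ P.big.Q N.D))

/-- `c` is the Atiyah class `[α^E_∇]` computed from the connection `∇`: it is the class of a
cocycle `α` of degree `2` with values in `A^⊥ ⊗ End(E)` and `α = (J ⊗ 1)(R^∇)`. -/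
def IsAtiyahClassOf (N : ConnectionForm ℒ ℰ) (c : (P.perpComplex M).H (1 + 1)) : Prop :=
  ∃ (α : O 𝒜 ⊗[K] (P.perp ⊗[K] Module.End K E)) (hα : α ∈ (P.perpComplex M).cocycles (1 + 1)),
    P.incl E α = P.curvatureForm N ∧ c = (P.perpComplex M).cls (1 + 1) α hα

end SHLiePair

end SHLie

/-! The connecting map is computed on an explicit lift. For an extension $D^{L,E}$ of $D^{A,E}$, the
element $y = (J\otimes 1)(D^{L,E})$ (`jetForm`) projects to $(I^A\otimes 1)(D^{A,E})$, because
$(1\otimes j^\vee)J = I^A j^\vee$ (`proj_jetForm`). Everything then rests on the identity $dy =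
(J\otimes 1)(R^\nabla)$, which is `curvatureForm_eq_d`: once it is known, the preimage of $dy$ in
the $A^\perp$-complex is $\alpha^E_\nabla$ by the definition of $\delta$, whichever $\nabla$ was
chosen.

Two properties of $J$ give the identity. It is a graded derivation along $j^\vee$ (`J_mul`), so on
$D\circ D$ it produces the graded commutator of $D^{A,E}$ with $y$. It also intertwines $Q_L$ with
$Q_A + D^{L^\vee}$ (`J_Q`), which handles the term $Q_L(D)$. The second property holds on linear
forms by the definition of $D^{L^\vee}$. The defect of the intertwining is linear over $j^\vee$ up
to sign, so it vanishes on all of $\mathcal O(L)$. Polynomials do not suffice here and no continuity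
of $Q_L$ is assumed, so the passage to power series is an induction on the order of the output
(`CSym.eq_zero_of_ι_mul`).

That $d^2=0$ on the $L^\vee$-complex follows from flatness of $D^{L^\vee}$ (a consequence of `J_Q`
and $Q_L^2=0$), flatness of the induced connection on $\operatorname{End}(E)$, and the fact that
tensor products of flat connections are flat. The $A^\perp$-complex inherits this by injectivity of
the inclusion. The $A^\vee$-complex is the $L^\vee$-complex of the pair $(A,A)$, and the key
identity for that pair says that $d$ of $(I^A\otimes 1)(D^{A,E})$ is built from the curvature of
$E$, hence is zero. A retraction $L\to A$ of degree $0$ provides both the splitting of the sequence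
and an extension of the connection. -/

namespace SHLie

/-! ### Koszul signs -/

section Signs

variable {K : Type*} [Field K]

/-- Every comparison of Koszul signs below is reduced by this lemma to a parity statement about
integer exponents. -/
theorem neg_one_zpow_congr {a b : ℤ} (h : Even a ↔ Even b) : (-1 : K) ^ a = (-1) ^ b := by
  by_cases ha : Even a
  · rw [ha.neg_one_zpow, (h.mp ha).neg_one_zpow]
  · rw [(Int.not_even_iff_odd.mp ha).neg_one_zpow,
      (Int.not_even_iff_odd.mp (mt h.mpr ha)).neg_one_zpow]

theorem neg_one_zpow_mul (a b : ℤ) : (-1 : K) ^ a * (-1) ^ b = (-1) ^ (a + b) :=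
  (zpow_add₀ (by simp) a b).symm

end Signs

/-! ### Degrees in tensor products -/

section TensorDegrees

variable {K : Type*} [Field K] {X Y Z : Type*} [AddCommGroup X] [Module K X]
  [AddCommGroup Y] [Module K Y] [AddCommGroup Z] [Module K Z]

theorem Grading.tmul_mem (g : Grading K X) (h : Grading K Y) {i j n : ℤ} {x : X} {y : Y}
    (hx : x ∈ g.deg i) (hy : y ∈ h.deg j) (hn : i + j = n) :
    x ⊗ₜ[K] y ∈ (g.tensor h).deg n := by
  obtain rfl : j = n - i := by omega
  exact Submodule.mem_iSup_of_mem i (Submodule.apply_mem_map₂ (TensorProduct.mk K X Y) hx hy)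

theorem Grading.tensor_deg_le (g : Grading K X) (h : Grading K Y) {n : ℤ}
    {S : Submodule K (X ⊗[K] Y)}
    (hS : ∀ i j x y, i + j = n → x ∈ g.deg i → y ∈ h.deg j → x ⊗ₜ[K] y ∈ S) :
    (g.tensor h).deg n ≤ S :=
  iSup_le fun i => Submodule.map₂_le.mpr fun x hx y hy =>
    hS i (n - i) x y (by omega) hx hy

theorem Grading.map_mem_deg (g : Grading K X) (h : Grading K Y) {n : ℤ} {f : X ⊗[K] Y →ₗ[K] Z}
    {S : Submodule K Z}
    (hS : ∀ i j x y, i + j = n → x ∈ g.deg i → y ∈ h.deg j → f (x ⊗ₜ y) ∈ S)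
    {z : X ⊗[K] Y} (hz : z ∈ (g.tensor h).deg n) : f z ∈ S :=
  g.tensor_deg_le h (S := S.comap f) hS hz

/-- A tensor of degree `n` is a finite sum of homogeneous pure tensors. -/
theorem Grading.exists_sum_tmul (g : Grading K X) (h : Grading K Y) {n : ℤ} {z : X ⊗[K] Y}
    (hz : z ∈ (g.tensor h).deg n) :
    ∃ (k : ℕ) (x : Fin k → X) (y : Fin k → Y) (i : Fin k → ℤ),
      (∀ t, x t ∈ g.deg (i t)) ∧ (∀ t, y t ∈ h.deg (n - i t)) ∧ z = ∑ t, x t ⊗ₜ[K] y t := by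
  -- The finite sums of homogeneous pure tensors form a submodule (concatenate the two families), so
  -- it suffices that this submodule contains the pure tensors spanning the degree $n$ part.
  let S : Submodule K (X ⊗[K] Y) :=
    { carrier := {z | ∃ (k : ℕ) (x : Fin k → X) (y : Fin k → Y) (i : Fin k → ℤ),
        (∀ t, x t ∈ g.deg (i t)) ∧ (∀ t, y t ∈ h.deg (n - i t)) ∧ z = ∑ t, x t ⊗ₜ[K] y t}
      zero_mem' := ⟨0, Fin.elim0, Fin.elim0, Fin.elim0, fun t => t.elim0, fun t => t.elim0, by simp⟩
      add_mem' := by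
        rintro _ _ ⟨k, x, y, i, hx, hy, rfl⟩ ⟨k', x', y', i', hx', hy', rfl⟩
        refine ⟨k + k', Fin.append x x', Fin.append y y', Fin.append i i', ?_, ?_, ?_⟩
        · intro t; refine Fin.addCases (fun t => ?_) (fun t => ?_) t <;> simp [hx, hx']
        · intro t; refine Fin.addCases (fun t => ?_) (fun t => ?_) t <;> simp [hy, hy']
        · simp [Fin.sum_univ_add]
      smul_mem' := by
        rintro r _ ⟨k, x, y, i, hx, hy, rfl⟩
        exact ⟨k, fun t => r • x t, y, i, fun t => Submodule.smul_mem _ _ (hx t), hy, by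
          simp [Finset.smul_sum, TensorProduct.smul_tmul']⟩ }
  refine g.tensor_deg_le h (S := S) (fun i j x y hn hx hy => ?_) hz
  obtain rfl : j = n - i := by omega
  exact ⟨1, fun _ => x, fun _ => y, fun _ => i, by simpa, by simpa, by simp⟩

theorem Grading.lTensor_mem_deg (g : Grading K X) (h : Grading K Y) (h' : Grading K Z)
    {f : Y →ₗ[K] Z} (hf : ∀ n, ∀ y ∈ h.deg n, f y ∈ h'.deg n) {n : ℤ} {z : X ⊗[K] Y}
    (hz : z ∈ (g.tensor h).deg n) : f.lTensor X z ∈ (g.tensor h').deg n :=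
  g.map_mem_deg h (fun _ _ _ _ hn hx hy => g.tmul_mem h' hx (hf _ _ hy) hn) hz

theorem Grading.rTensor_mem_deg (g : Grading K X) (h : Grading K Y) (h' : Grading K Z)
    {f : X →ₗ[K] Z} (hf : ∀ n, ∀ x ∈ g.deg n, f x ∈ h'.deg n) {n : ℤ} {z : X ⊗[K] Y}
    (hz : z ∈ (g.tensor h).deg n) : f.rTensor Y z ∈ (h'.tensor h).deg n :=
  g.map_mem_deg h (fun _ _ _ _ hn hx hy => h'.tmul_mem h (hf _ _ hx) hy hn) hz

theorem Grading.assoc_mem_deg (g : Grading K X) (h : Grading K Y) (h' : Grading K Z) {n : ℤ}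
    {z : (X ⊗[K] Y) ⊗[K] Z} (hz : z ∈ ((g.tensor h).tensor h').deg n) :
    TensorProduct.assoc K X Y Z z ∈ (g.tensor (h.tensor h')).deg n := by
  refine Grading.map_mem_deg (g.tensor h) h' (f := (TensorProduct.assoc K X Y Z).toLinearMap)
    (fun i j x y hn hx hy => ?_) hz
  refine Grading.map_mem_deg g h (f := (TensorProduct.assoc K X Y Z).toLinearMap ∘ₗ
    (TensorProduct.mk K _ _).flip y) (fun k l a b hkl ha hb => ?_) hx
  exact g.tmul_mem _ ha (h.tmul_mem h' hb hy rfl) (by omega)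

end TensorDegrees

/-! ### Homogeneous bases and their dual bases -/

section HomogeneousBasis

variable {K : Type*} [Field K] {V : Type*} [AddCommGroup V] [Module K V]

/-- A finite-dimensional graded vector space has a finite homogeneous basis. -/
theorem exists_homogeneous_basis [FiniteDimensional K V] (𝒱 : ℤ → Submodule K V)
    [DirectSum.Decomposition 𝒱] :
    ∃ (k : ℕ) (b : Module.Basis (Fin k) K V) (m : Fin k → ℤ), ∀ i, b i ∈ 𝒱 (m i) := by
  let b := (DirectSum.Decomposition.isInternal 𝒱).collectedBasis
    fun i => Module.Free.chooseBasis K (𝒱 i)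
  have : Fintype (Σ i, Module.Free.ChooseBasisIndex K (𝒱 i)) :=
    FiniteDimensional.fintypeBasisIndex b
  let e := Fintype.equivFin (Σ i, Module.Free.ChooseBasisIndex K (𝒱 i))
  refine ⟨_, b.reindex e, fun i => (e.symm i).1, fun i => ?_⟩
  rw [Module.Basis.reindex_apply]
  exact DirectSum.IsInternal.collectedBasis_mem _ _ _

theorem coord_mem_dual_deg {𝒱 : ℤ → Submodule K V} [DirectSum.Decomposition 𝒱]
    {k : ℕ} {b : Module.Basis (Fin k) K V} {m : Fin k → ℤ} (hb : ∀ i, b i ∈ 𝒱 (m i)) (i : Fin k) :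
    b.coord i ∈ (Grading.dual 𝒱).deg (-m i) := by
  intro n hn v hv
  rw [neg_neg] at hn
  -- `p` is the projection onto the homogeneous component of `b i`. The coordinate form factors
  -- through it, as one sees on the basis, and therefore kills all other components.
  let p : V →ₗ[K] V := (𝒱 (m i)).subtype ∘ₗ DirectSum.component K ℤ (fun n => 𝒱 n) (m i) ∘ₗ
    (DirectSum.decomposeLinearEquiv 𝒱).toLinearMap
  have hp : ∀ x, p x = DirectSum.decompose 𝒱 x (m i) := fun x => rfl
  have key : b.coord i ∘ₗ p = b.coord i := by
    refine b.ext fun l => ?_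
    rw [LinearMap.comp_apply, hp]
    by_cases hl : m l = m i
    · rw [DirectSum.decompose_of_mem_same 𝒱 (hl ▸ hb l)]
    · rw [DirectSum.decompose_of_mem_ne 𝒱 (hb l) hl, map_zero, Module.Basis.coord_apply,
        Module.Basis.repr_self, Finsupp.single_eq_of_ne (by rintro rfl; exact hl rfl)]
  rw [← key, LinearMap.comp_apply, hp, DirectSum.decompose_of_mem_ne 𝒱 hv hn, map_zero]

end HomogeneousBasis

/-! ### Bigraded structure and right contraction on the symmetric algebra -/

namespace Sym

variable {K : Type*} [Field K] {W : Type*} [AddCommGroup W] [Module K W] {g : Grading K W}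

theorem ι_mul_mem_bideg {m d : ℤ} {n : ℕ} {w : W} {x : Sym g} (hw : w ∈ g.deg m)
    (hx : x ∈ bideg g n d) : ι g w * x ∈ bideg g (n + 1) (m + d) := by
  suffices h : bideg g n d ≤ (bideg g (n + 1) (m + d)).comap (LinearMap.mulLeft K (ι g w)) from h hx
  refine Submodule.span_le.mpr ?_
  rintro _ ⟨l, rfl, hl, rfl, rfl⟩
  refine Submodule.subset_span ⟨(m, w) :: l, by simp, ?_, by simp, by simp⟩
  rintro p hp
  rcases List.mem_cons.mp hp with rfl | hp
  exacts [hw, hl p hp]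

theorem one_mem_bideg : (1 : Sym g) ∈ bideg g 0 0 :=
  Submodule.subset_span ⟨[], rfl, by simp, by simp, by simp⟩

/-- Each bigraded piece is spanned by words in homogeneous generators, so induction over the span
followed by induction over the word allows generators to be added on the left one at a time. The
motive carries weight and degree, so that signs can depend on them. -/
theorem bideg_induction {C : ∀ (n : ℕ) (d : ℤ) (x : Sym g), x ∈ bideg g n d → Prop}
    (zero : ∀ n d, C n d 0 (zero_mem _))
    (add : ∀ n d x y hx hy, C n d x hx → C n d y hy → C n d (x + y) (add_mem hx hy))
    (smul : ∀ n d (r : K) x hx, C n d x hx → C n d (r • x) (Submodule.smul_mem _ r hx))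
    (one : C 0 0 1 one_mem_bideg)
    (ι_mul : ∀ n d m w x (hw : w ∈ g.deg m) (hx : x ∈ bideg g n d), C n d x hx →
      C (n + 1) (m + d) (ι g w * x) (ι_mul_mem_bideg hw hx)) {n : ℕ} {d : ℤ} {x : Sym g}
    (hx : x ∈ bideg g n d) : C n d x hx := by
  induction hx using Submodule.span_induction with
  | zero => exact zero n d
  | add x y hx hy hCx hCy => exact add n d x y hx hy hCx hCy
  | smul r x hx hC => exact smul n d r x hx hC
  | mem x hx =>
    obtain ⟨l, rfl, hl, rfl, rfl⟩ := hx
    induction l with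
    | nil => simpa using one
    | cons p l ih =>
      simp only [List.length_cons, List.map_cons, List.sum_cons, List.prod_cons]
      have hl' := fun q hq => hl q (List.mem_cons_of_mem _ hq)
      exact ι_mul _ _ _ _ _ (hl p List.mem_cons_self)
        (Submodule.subset_span ⟨l, rfl, hl', rfl, rfl⟩) (ih hl')

theorem mul_mem_bideg {n n' : ℕ} {d d' : ℤ} {x y : Sym g} (hx : x ∈ bideg g n d)
    (hy : y ∈ bideg g n' d') : x * y ∈ bideg g (n + n') (d + d') := by
  induction hx using bideg_induction with
  | zero n d => simp
  | add n d x x' _ _ hx hx' => rw [add_mul]; exact add_mem hx hx'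
  | smul n d r x _ hx => rw [smul_mul_assoc]; exact Submodule.smul_mem _ _ hx
  | one => simpa
  | ι_mul n d m w x hw _ hx =>
    rw [mul_assoc, add_right_comm, add_assoc m]; exact ι_mul_mem_bideg hw hx

theorem ι_mul_comm {n : ℕ} {m d : ℤ} {w : W} {x : Sym g} (hw : w ∈ g.deg m)
    (hx : x ∈ bideg g n d) : ι g w * x = ((-1 : K) ^ (m * d)) • (x * ι g w) := by
  induction hx using bideg_induction with
  | zero n d => simp
  | add n d x x' _ _ hx hx' => rw [mul_add, hx, hx', add_mul, smul_add]
  | smul n d r x _ hx => rw [mul_smul_comm, hx, smul_mul_assoc, smul_comm]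
  | one => simp
  | ι_mul n d k u x hu _ hx =>
    rw [← mul_assoc, ι_comm g hw hu, smul_mul_assoc, mul_assoc, hx, mul_smul_comm, smul_smul,
      neg_one_zpow_mul, mul_assoc, mul_add]

theorem mul_comm_bideg {n n' : ℕ} {d d' : ℤ} {x y : Sym g} (hx : x ∈ bideg g n d)
    (hy : y ∈ bideg g n' d') : x * y = ((-1 : K) ^ (d * d')) • (y * x) := by
  induction hx using bideg_induction with
  | zero n d => simp
  | add n d x x' _ _ hx hx' => rw [add_mul, hx, hx', mul_add, smul_add]
  | smul n d r x _ hx => rw [smul_mul_assoc, hx, mul_smul_comm, smul_comm]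
  | one => simp
  | ι_mul n d m w x hw _ hx =>
    rw [mul_assoc, hx, mul_smul_comm, ← mul_assoc, ι_mul_comm hw hy, smul_mul_assoc, smul_smul,
      neg_one_zpow_mul, mul_assoc, add_mul, add_comm]

theorem bideg_le_weight (n : ℕ) (d : ℤ) : bideg g n d ≤ weight g n := by
  intro x hx
  induction hx using bideg_induction with
  | zero n d => simp
  | add n d x x' _ _ hx hx' => exact add_mem hx hx'
  | smul n d r x _ hx => exact Submodule.smul_mem _ _ hx
  | one => rw [weight, pow_zero]; exact Submodule.one_le.mp le_rfl
  | ι_mul n d m w x hw hx ih => rw [weight, pow_succ']; exact Submodule.mul_mem_mul ⟨w, rfl⟩ ih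

section Contr

variable [CharZero K]

/-- For homogeneous `w` only one of its even and odd parts survives in `contr_ι_mul`. In the odd
case the parity operator contributes $(-1)^d$, which has the same parity as $(-1)^{md}$. -/
theorem contr_ι_mul_of_mem (c : Module.Dual K W) {m d : ℤ} {n : ℕ} {w : W} {x : Sym g}
    (hw : w ∈ g.deg m) (hx : x ∈ bideg g n d) :
    contr g c (ι g w * x) = ((-1 : K) ^ (m * d) * c w) • x + ι g w * contr g c x := by
  rw [contr_ι_mul]
  congr 1
  simp only [Grading.even, Grading.odd, LinearMap.smul_apply, LinearMap.add_apply,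
    LinearMap.sub_apply, LinearMap.id_apply, g.sgn_apply m w hw, map_smul, map_add, map_sub,
    sgn_of_mem_bideg g hx]
  rcases Int.even_or_odd m with hm | hm
  · rw [hm.neg_one_zpow, (hm.mul_right d).neg_one_zpow]
    simp only [smul_eq_mul]; module
  · rw [neg_one_zpow_congr (a := m * d) (b := d)
      (by simp [Int.even_mul, Int.not_even_iff_odd.mpr hm]), hm.neg_one_zpow]
    simp only [smul_eq_mul]; module

/-- The graded Leibniz rule for right contraction. -/
theorem contr_mul (c : Module.Dual K W) {n n' : ℕ} {d d' : ℤ} {x y : Sym g}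
    (hx : x ∈ bideg g n d) (hy : y ∈ bideg g n' d') :
    contr g c (x * y) = x * contr g c y + ((-1 : K) ^ (d * d')) • (y * contr g c x) := by
  induction hx using bideg_induction with
  | zero n d => simp
  | add n d x x' _ _ hx hx' => rw [add_mul, map_add, hx, hx', add_mul, map_add, mul_add]; module
  | smul n d r x _ hx => simp only [smul_mul_assoc, map_smul, hx, mul_smul_comm]; module
  | one => simp
  | ι_mul n d m w x hw hx ih =>
    -- `hyw` and `hyx` bring all products into the order $w, x, y$. The coefficients then differ
    -- only by squares of signs, which `hd` and `hm` replace by $1$.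
    have hyw (z : Sym g) :
        y * (ι g w * z) = ((-1 : K) ^ (m * d')) • (ι g w * (y * z)) := by
      rw [← mul_assoc (ι g w), ι_mul_comm hw hy, smul_mul_assoc, smul_smul, neg_one_zpow_mul,
        Even.neg_one_zpow ⟨_, rfl⟩, one_smul, mul_assoc]
    have hyx : y * x = ((-1 : K) ^ (d * d')) • (x * y) := by
      rw [mul_comm_bideg hy hx, mul_comm d']
    rw [mul_assoc, contr_ι_mul_of_mem c hw (mul_mem_bideg hx hy), contr_ι_mul_of_mem c hw hx, ih]
    simp only [mul_add, add_mul, mul_smul_comm, smul_add, smul_smul, hyw, hyx, mul_assoc]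
    have hd : (-1 : K) ^ (d * d') * (-1 : K) ^ (d * d') = 1 := by
      rw [neg_one_zpow_mul]; exact Even.neg_one_zpow ⟨_, rfl⟩
    have hm : (-1 : K) ^ (m * d') * (-1 : K) ^ (m * d') = 1 := by
      rw [neg_one_zpow_mul]; exact Even.neg_one_zpow ⟨_, rfl⟩
    rw [← neg_one_zpow_mul, ← neg_one_zpow_mul, add_left_comm]
    congr 2
    · congr 1
      linear_combination (-(-1 : K) ^ (m * d) * (-1 : K) ^ (m * d') * c w) * hd
    · congr 1
      linear_combination (-(-1 : K) ^ (d * d')) * hm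

theorem contr_of_mem_weight_zero (c : Module.Dual K W) {x : Sym g} (hx : x ∈ weight g 0) :
    contr g c x = 0 := by
  obtain ⟨r, rfl⟩ := by simpa [weight, Submodule.mem_one] using hx
  simp [Algebra.algebraMap_eq_smul_one]

/-- The hypothesis `hc` says that the form `c` has degree `e`, being supported in degree $-e$. In
the recursion, either the constant $c(w)$ vanishes or $w$ has degree exactly $-e$. -/
theorem contr_mem_bideg {c : Module.Dual K W} {e : ℤ} (hc : ∀ m, m + e ≠ 0 → ∀ w ∈ g.deg m, c w = 0)
    {n : ℕ} {d : ℤ} {x : Sym g} (hx : x ∈ bideg g (n + 1) d) :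
    contr g c x ∈ bideg g n (d + e) := by
  -- The weight becomes a variable so that `bideg_induction` applies; the equation `hk` excludes the
  -- empty word.
  obtain ⟨k, hk⟩ : ∃ k, k = n + 1 := ⟨_, rfl⟩
  rw [← hk] at hx
  induction hx using bideg_induction generalizing n with
  | zero k d => rw [map_zero]; exact zero_mem _
  | add k d x x' _ _ hx hx' => rw [map_add]; exact add_mem (hx hk) (hx' hk)
  | smul k d r x _ hx => rw [map_smul]; exact Submodule.smul_mem _ _ (hx hk)
  | one => omega
  | ι_mul k d m w x hw hx ih =>
    obtain rfl : k = n := by omega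
    rw [contr_ι_mul_of_mem c hw hx]
    refine add_mem ?_ ?_
    · by_cases hm : m + e = 0
      · rw [add_right_comm, hm, zero_add]; exact Submodule.smul_mem _ _ hx
      · rw [hc m hm w hw, mul_zero, zero_smul]; exact zero_mem _
    · cases k with
      | zero =>
        rw [contr_of_mem_weight_zero c (bideg_le_weight _ _ hx), mul_zero]; exact zero_mem _
      | succ n => rw [add_assoc]; exact ι_mul_mem_bideg hw (ih rfl)

end Contr

theorem map_mem_bideg {W' : Type*} [AddCommGroup W'] [Module K W'] {g' : Grading K W'}
    (f : W →ₗ[K] W') (hf : ∀ n, ∀ x ∈ g.deg n, f x ∈ g'.deg n) {n : ℕ} {d : ℤ} {x : Sym g}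
    (hx : x ∈ bideg g n d) : map f hf x ∈ bideg g' n d := by
  induction hx using bideg_induction with
  | zero n d => simp
  | add n d x x' _ _ hx hx' => rw [map_add]; exact add_mem hx hx'
  | smul n d r x _ hx => rw [map_smul]; exact Submodule.smul_mem _ _ hx
  | one => simpa using one_mem_bideg
  | ι_mul n d m w x hw hx ih => rw [map_mul, map_ι]; exact ι_mul_mem_bideg (hf _ _ hw) ih

/-- Elements of `S^{n+1}(W)^d` can be expanded along a finite homogeneous spanning family. -/
theorem exists_sum_ι_mul {k : ℕ} {ξ : Fin k → W} {m : Fin k → ℤ}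
    (hspan : ∀ d, ∀ w ∈ g.deg d, ∃ a : Fin k → K, (∀ i, m i ≠ d → a i = 0) ∧ w = ∑ i, a i • ξ i)
    {n : ℕ} {d : ℤ} {x : Sym g} (hx : x ∈ bideg g (n + 1) d) :
    ∃ y : Fin k → Sym g, (∀ i, y i ∈ bideg g n (d - m i)) ∧ x = ∑ i, ι g (ξ i) * y i := by
  induction hx using Submodule.span_induction with
  | zero => exact ⟨0, by simp, by simp⟩
  | add x x' _ _ hx hx' =>
    obtain ⟨y, hy, rfl⟩ := hx
    obtain ⟨y', hy', rfl⟩ := hx'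
    exact ⟨y + y', fun i => add_mem (hy i) (hy' i), by simp [mul_add, Finset.sum_add_distrib]⟩
  | smul r x _ hx =>
    obtain ⟨y, hy, rfl⟩ := hx
    exact ⟨r • y, fun i => Submodule.smul_mem _ _ (hy i), by simp [Finset.smul_sum]⟩
  | mem x hx =>
    obtain ⟨l, hl, hmem, rfl, rfl⟩ := hx
    obtain ⟨p, l, rfl⟩ := List.exists_cons_of_length_eq_add_one hl
    obtain ⟨a, ha, hw⟩ := hspan _ _ (hmem p List.mem_cons_self)
    -- The first letter of the word is expanded in the family and the rest of the word becomes the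
    -- cofactor. Where the degree of `ξ i` does not match that of the letter, the coefficient is
    -- zero, so the degree condition still holds.
    refine ⟨fun i => a i • (l.map fun p => ι g p.2).prod, fun i => ?_, ?_⟩
    · by_cases hi : m i = p.1
      · refine Submodule.smul_mem _ _ (Submodule.subset_span ⟨l, by simpa using hl,
          fun q hq => hmem q (List.mem_cons_of_mem _ hq), by simp [hi], rfl⟩)
      · simp [ha i hi]
    · simp only [List.map_cons, List.prod_cons]
      rw [hw, map_sum, Finset.sum_mul]
      simp

end Sym

/-! ### Power series: degrees, Leibniz rule, vanishing criterion -/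

namespace CSym

variable {K : Type*} [Field K] {W : Type*} [AddCommGroup W] [Module K W] {g : Grading K W}

theorem one_mem_deg : (1 : CSym g) ∈ (grading g).deg 0 := by
  intro n
  rw [coeff_one]
  split_ifs with h
  · subst h; exact Sym.one_mem_bideg
  · exact zero_mem _

theorem ι_mem_deg {m : ℤ} {w : W} (hw : w ∈ g.deg m) : ι g w ∈ (grading g).deg m := by
  intro n
  simp only [ι, LinearMap.coe_mk, AddHom.coe_mk, coeff_ofCoeff]
  split_ifs with h
  · subst h
    simpa using Sym.ι_mul_mem_bideg hw (Sym.one_mem_bideg (g := g))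
  · exact zero_mem _

theorem mul_mem_deg {d d' : ℤ} {x y : CSym g} (hx : x ∈ (grading g).deg d)
    (hy : y ∈ (grading g).deg d') : x * y ∈ (grading g).deg (d + d') := by
  intro n
  rw [coeff_mul]
  refine sum_mem fun p hp => ?_
  rw [← Finset.HasAntidiagonal.mem_antidiagonal.mp hp]
  exact Sym.mul_mem_bideg (hx _) (hy _)

theorem mul_comm_deg {d d' : ℤ} {x y : CSym g} (hx : x ∈ (grading g).deg d)
    (hy : y ∈ (grading g).deg d') : x * y = ((-1 : K) ^ (d * d')) • (y * x) := by
  ext n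
  rw [map_smul, coeff_mul, coeff_mul, ← Finset.Nat.sum_antidiagonal_swap, Finset.smul_sum]
  exact Finset.sum_congr rfl fun p _ => Sym.mul_comm_bideg (hx _) (hy _)

theorem map_mem_deg {W' : Type*} [AddCommGroup W'] [Module K W'] {g' : Grading K W'}
    (f : W →ₗ[K] W') (hf : ∀ n, ∀ x ∈ g.deg n, f x ∈ g'.deg n) {d : ℤ} {x : CSym g}
    (hx : x ∈ (grading g).deg d) : map f hf x ∈ (grading g').deg d := by
  intro n
  rw [coeff_map]
  exact Sym.map_mem_bideg f hf (hx n)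

theorem coeff_zero_ι_mul (w : W) (x : CSym g) : coeff 0 (ι g w * x) = 0 := by
  simp [coeff_mul, ι]

theorem coeff_succ_ι_mul (w : W) (x : CSym g) (n : ℕ) :
    coeff (n + 1) (ι g w * x) = Sym.ι g w * coeff n x := by
  rw [coeff_mul, Finset.sum_eq_single (1, n)]
  · simp [ι]
  · rintro ⟨p, q⟩ hpq hne
    rw [Finset.HasAntidiagonal.mem_antidiagonal] at hpq
    have hp : p ≠ 1 := by rintro rfl; exact hne (by ext <;> simp at hpq ⊢; omega)
    simp [ι, hp]
  · intro h; exact absurd (Finset.HasAntidiagonal.mem_antidiagonal.mpr (add_comm 1 n)) h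

theorem contr_mem_deg [CharZero K] {c : Module.Dual K W} {e : ℤ}
    (hc : ∀ m, m + e ≠ 0 → ∀ w ∈ g.deg m, c w = 0) {d : ℤ} {x : CSym g}
    (hx : x ∈ (grading g).deg d) : contr c x ∈ (grading g).deg (d + e) := by
  intro n
  rw [coeff_contr]
  exact Sym.contr_mem_bideg hc (hx _)

theorem contr_ι [CharZero K] (c : Module.Dual K W) {m : ℤ} {w : W} (hw : w ∈ g.deg m) :
    contr c (ι g w) = algebraMap K (CSym g) (c w) := by
  ext n
  rw [coeff_contr, Algebra.algebraMap_eq_smul_one, map_smul, coeff_one]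
  simp only [ι, LinearMap.coe_mk, AddHom.coe_mk, coeff_ofCoeff, Nat.add_eq_right]
  split_ifs with h
  · have := Sym.contr_ι_mul_of_mem c hw (Sym.one_mem_bideg (g := g))
    simpa using this
  · simp

/-- The graded Leibniz rule for right contraction. -/
theorem contr_mul [CharZero K] (c : Module.Dual K W) {d d' : ℤ} {x y : CSym g}
    (hx : x ∈ (grading g).deg d) (hy : y ∈ (grading g).deg d') :
    contr c (x * y) = x * contr c y + ((-1 : K) ^ (d * d')) • (y * contr c x) := by
  ext n
  -- The $n$th component of the contraction comes from weight $n+1$ of the product, so each of the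
  -- two sums has one term more than on the right-hand side. That extra term contracts a factor of
  -- weight $0$ and vanishes.
  rw [coeff_contr, map_add, map_smul, coeff_mul, coeff_mul, coeff_mul, map_sum,
    Finset.sum_congr rfl fun p _ => Sym.contr_mul c (hx p.1) (hy p.2), Finset.sum_add_distrib,
    Finset.Nat.sum_antidiagonal_succ', Finset.Nat.sum_antidiagonal_succ (n := n)]
  simp only [coeff_contr, Sym.contr_of_mem_weight_zero c (coeff_mem 0 _), mul_zero, smul_zero,
    zero_add]
  rw [Finset.smul_sum, ← Finset.Nat.sum_antidiagonal_swap (n := n) (f := fun p =>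
    ((-1 : K) ^ (d * d')) • (coeff p.1 y * Sym.contr g c (coeff (p.2 + 1) x)))]
  simp

/-- A homogeneous power series is a constant plus a combination of a finite homogeneous spanning
family of linear forms. -/
theorem exists_eq_add_sum_ι_mul {k : ℕ} {ξ : Fin k → W} {m : Fin k → ℤ}
    (hspan : ∀ d, ∀ w ∈ g.deg d, ∃ a : Fin k → K, (∀ i, m i ≠ d → a i = 0) ∧ w = ∑ i, a i • ξ i)
    {d : ℤ} {x : CSym g} (hx : x ∈ (grading g).deg d) :
    ∃ (r : K) (y : Fin k → CSym g), (∀ i, y i ∈ (grading g).deg (d - m i)) ∧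
      x = r • 1 + ∑ i, ι g (ξ i) * y i := by
  -- The same finite family `ξ` serves in every weight, so the cofactors found weight by weight
  -- assemble into one power series for each `i`. Only the component of weight $0$ is left over, as
  -- the constant `r`.
  choose y hy hxy using fun n => Sym.exists_sum_ι_mul hspan (hx (n + 1))
  obtain ⟨r, hr⟩ : ∃ r : K, algebraMap K (Sym g) r = coeff 0 x := by
    simpa [Sym.weight, Submodule.mem_one] using coeff_mem 0 x
  refine ⟨r, fun i => ofCoeff (fun n => y n i) fun n => Sym.bideg_le_weight _ _ (hy n i),
    fun i n => ?_, ?_⟩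
  · rw [coeff_ofCoeff]; exact hy n i
  · ext n
    rw [map_add, map_smul, map_sum, coeff_one]
    cases n with
    | zero => simp [coeff_zero_ι_mul, ← hr, Algebra.algebraMap_eq_smul_one]
    | succ n => simp [coeff_succ_ι_mul, hxy n]

/-- A linear map out of power series that kills constants and is linear, up to sign and along
multiplication by power series without constant term, over the linear forms, vanishes on
homogeneous elements. -/
theorem eq_zero_of_ι_mul {W' : Type*} [AddCommGroup W'] [Module K W'] {g' : Grading K W'}
    {k : ℕ} {ξ : Fin k → W} {m : Fin k → ℤ}
    (hspan : ∀ d, ∀ w ∈ g.deg d, ∃ a : Fin k → K, (∀ i, m i ≠ d → a i = 0) ∧ w = ∑ i, a i • ξ i)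
    (Δ : CSym g →ₗ[K] CSym g') (h1 : Δ 1 = 0)
    (hΔ : ∀ i d x, x ∈ (grading g).deg d →
      ∃ u : CSym g', coeff 0 u = 0 ∧ Δ (ι g (ξ i) * x) = u * Δ x)
    {d : ℤ} {x : CSym g} (hx : x ∈ (grading g).deg d) : Δ x = 0 := by
  ext n
  rw [map_zero]
  -- The induction is on the order of the output, for all `x` and `d` at once. Since `u` has no
  -- constant term, the $n$th component of `u * Δ (y i)` involves only components of `Δ (y i)` below
  -- `n`, and no continuity of `Δ` is required.
  induction n using Nat.strong_induction_on generalizing d x with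
  | _ n ih =>
    obtain ⟨r, y, hy, rfl⟩ := exists_eq_add_sum_ι_mul hspan hx
    rw [map_add, map_smul, h1, smul_zero, zero_add, map_sum, map_sum]
    refine Finset.sum_eq_zero fun i _ => ?_
    obtain ⟨u, hu, h⟩ := hΔ i _ _ (hy i)
    rw [h, coeff_mul]
    refine Finset.sum_eq_zero fun p hp => ?_
    rw [Finset.HasAntidiagonal.mem_antidiagonal] at hp
    by_cases hp1 : p.1 = 0
    · rw [hp1, hu, zero_mul]
    · rw [ih p.2 (by omega) (hy i), mul_zero]

end CSym

/-! ### Induction on tensors of fixed degree -/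

section Induction

variable {K : Type*} [Field K] {X Y : Type*} [AddCommGroup X] [Module K X]
  [AddCommGroup Y] [Module K Y]

theorem Grading.tensor_induction {g : Grading K X} {h : Grading K Y} {n : ℤ}
    {C : ∀ z : X ⊗[K] Y, z ∈ (g.tensor h).deg n → Prop} (zero : C 0 (zero_mem _))
    (add : ∀ z z' hz hz', C z hz → C z' hz' → C (z + z') (add_mem hz hz'))
    (tmul : ∀ i j x y (hx : x ∈ g.deg i) (hy : y ∈ h.deg j) (hn : i + j = n),
      C (x ⊗ₜ y) (g.tmul_mem h hx hy hn)) {z : X ⊗[K] Y} (hz : z ∈ (g.tensor h).deg n) :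
    C z hz := by
  have key : ∃ hz, C z hz := by
    obtain ⟨k, x, y, i, hx, hy, rfl⟩ := g.exists_sum_tmul h hz
    refine Finset.sum_induction _ (fun z => ∃ hz, C z hz) ?_ ⟨_, zero⟩ fun t _ => ⟨_,
      tmul (i t) _ _ _ (hx t) (hy t) (by omega)⟩
    rintro a b ⟨_, ha⟩ ⟨_, hb⟩
    exact ⟨_, add _ _ _ _ ha hb⟩
  exact key.2

end Induction

/-! ### Products of vector-valued forms -/

section Products

variable {K : Type*} [Field K] {L : Type*} [AddCommGroup L] [Module K L]
  {ℒ : ℤ → Submodule K L} [DirectSum.Decomposition ℒ]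
  {F E : Type*} [AddCommGroup F] [Module K F] [AddCommGroup E] [Module K E]

theorem smul_tmul_form (a b : O ℒ) (f : F) : a • (b ⊗ₜ[K] f) = (a * b) ⊗ₜ[K] f := by
  rw [TensorProduct.smul_tmul', smul_eq_mul]

theorem smul_mem_tensor_deg {gF : Grading K F} {i n : ℤ} {a : O ℒ} {x : O ℒ ⊗[K] F}
    (ha : a ∈ (CSym.grading (Grading.dual ℒ)).deg i)
    (hx : x ∈ ((CSym.grading (Grading.dual ℒ)).tensor gF).deg n) :
    a • x ∈ ((CSym.grading (Grading.dual ℒ)).tensor gF).deg (i + n) := by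
  induction hx using Grading.tensor_induction with
  | zero => rw [smul_zero]; exact zero_mem _
  | add x y _ _ hx hy => rw [smul_add]; exact add_mem hx hy
  | tmul k l b f hb hf hn =>
    rw [smul_tmul_form]
    exact Grading.tmul_mem _ _ (CSym.mul_mem_deg ha hb) hf (by omega)

theorem assoc_smul_tmul (a : O ℒ) (x : O ℒ ⊗[K] F) (e : E) :
    TensorProduct.assoc K (O ℒ) F E ((a • x) ⊗ₜ e) =
      a • TensorProduct.assoc K (O ℒ) F E (x ⊗ₜ e) := by
  induction x with
  | zero => simp
  | add x y hx hy => simp only [smul_add, TensorProduct.add_tmul, map_add, hx, hy]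
  | tmul b f => rw [smul_tmul_form, TensorProduct.assoc_tmul, TensorProduct.assoc_tmul, smul_tmul_form]

variable (gF : Grading K F)

/-- The product `(a ⊗ f) · (b ⊗ e) = (-1)^(|f||b|) ab ⊗ (f ⊗ e)` of forms with values in `F`
and forms with values in `E`. -/
noncomputable def formMul : O ℒ ⊗[K] F →ₗ[K] O ℒ ⊗[K] E →ₗ[K] O ℒ ⊗[K] (F ⊗[K] E) :=
  TensorProduct.lift (LinearMap.mk₂ K
    (fun a f => Algebra.lsmul K K (O ℒ ⊗[K] (F ⊗[K] E)) a ∘ₗ insertLeft gF f)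
    (fun a a' f => by rw [map_add, LinearMap.add_comp])
    (fun r a f => by rw [map_smul, LinearMap.smul_comp])
    (fun a f f' => by rw [map_add, LinearMap.comp_add])
    (fun r a f => by rw [map_smul, LinearMap.comp_smul]))

theorem formMul_tmul_apply (a : O ℒ) (f : F) (y : O ℒ ⊗[K] E) :
    formMul gF (a ⊗ₜ f) y = a • insertLeft gF f y := rfl

theorem smul_formMul (a : O ℒ) (x : O ℒ ⊗[K] F) (y : O ℒ ⊗[K] E) :
    formMul gF (a • x) y = a • formMul gF x y := by
  induction x with
  | zero => simp
  | add x y hx hy => simp only [smul_add, map_add, LinearMap.add_apply, hx, hy]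
  | tmul b f => rw [smul_tmul_form, formMul_tmul_apply, formMul_tmul_apply, mul_smul]

variable [CharZero K] {gF}

theorem formMul_tmul_tmul {a b : O ℒ} {f : F} {m n : ℤ} (hf : f ∈ gF.deg m)
    (hb : b ∈ (CSym.grading (Grading.dual ℒ)).deg n) (e : E) :
    formMul gF (a ⊗ₜ f) (b ⊗ₜ[K] e) = ((-1 : K) ^ (m * n)) • ((a * b) ⊗ₜ[K] (f ⊗ₜ[K] e)) := by
  rw [formMul_tmul_apply, insertLeft_tmul gF hf hb, smul_comm, smul_tmul_form]

/-- Moving `b` to the front costs $(-1)^{|f||b|}$ from passing `f` and $(-1)^{|a||b|}$ from passing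
`a`, so the sign depends only on the total degree `k` of `x`. -/
theorem formMul_tmul {x : O ℒ ⊗[K] F} {k n : ℤ} {b : O ℒ}
    (hx : x ∈ ((CSym.grading (Grading.dual ℒ)).tensor gF).deg k)
    (hb : b ∈ (CSym.grading (Grading.dual ℒ)).deg n) (e : E) :
    formMul gF x (b ⊗ₜ[K] e) =
      ((-1 : K) ^ (k * n)) • b • TensorProduct.assoc K (O ℒ) F E (x ⊗ₜ e) := by
  induction hx using Grading.tensor_induction with
  | zero => simp
  | add x y _ _ hx hy =>
    simp only [map_add, LinearMap.add_apply, hx, hy, TensorProduct.add_tmul, smul_add]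
  | tmul i j a f ha hf hn =>
    rw [formMul_tmul_tmul hf hb, TensorProduct.assoc_tmul, smul_tmul_form, CSym.mul_comm_deg ha hb,
      ← TensorProduct.smul_tmul', smul_smul, neg_one_zpow_mul, ← hn]
    congr 2
    ring

/-- This presents a reassociated tensor as a product of forms, so that the Leibniz rule
`connection_formMul` becomes applicable to it. -/
theorem formMul_one_tmul {x : O ℒ ⊗[K] F} {k : ℤ}
    (hx : x ∈ ((CSym.grading (Grading.dual ℒ)).tensor gF).deg k) (e : E) :
    formMul gF x (1 ⊗ₜ[K] e) = TensorProduct.assoc K (O ℒ) F E (x ⊗ₜ e) := by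
  rw [formMul_tmul hx CSym.one_mem_deg, mul_zero, zpow_zero, one_smul, one_smul]

theorem formMul_smul_of_mem {gE : Grading K E} {x : O ℒ ⊗[K] F} {y : O ℒ ⊗[K] E} {k n l : ℤ}
    {b : O ℒ} (hx : x ∈ ((CSym.grading (Grading.dual ℒ)).tensor gF).deg k)
    (hb : b ∈ (CSym.grading (Grading.dual ℒ)).deg n)
    (hy : y ∈ ((CSym.grading (Grading.dual ℒ)).tensor gE).deg l) :
    formMul gF x (b • y) = ((-1 : K) ^ (k * n)) • b • formMul gF x y := by
  induction hy using Grading.tensor_induction with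
  | zero => simp
  | add y z _ _ hy hz => simp only [smul_add, map_add, hy, hz]
  | tmul i j c e hc he hn =>
    rw [smul_tmul_form, formMul_tmul hx hc, formMul_tmul hx (CSym.mul_mem_deg hb hc),
      smul_comm b, ← mul_smul b c, smul_smul ((-1 : K) ^ _) ((-1 : K) ^ _), neg_one_zpow_mul, mul_add]

theorem formMul_mem_deg {gE : Grading K E} {x : O ℒ ⊗[K] F} {y : O ℒ ⊗[K] E} {k l : ℤ}
    (hx : x ∈ ((CSym.grading (Grading.dual ℒ)).tensor gF).deg k)
    (hy : y ∈ ((CSym.grading (Grading.dual ℒ)).tensor gE).deg l) :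
    formMul gF x y ∈ ((CSym.grading (Grading.dual ℒ)).tensor (gF.tensor gE)).deg (k + l) := by
  induction hy using Grading.tensor_induction with
  | zero => simp
  | add y z _ _ hy hz => rw [map_add]; exact add_mem hy hz
  | tmul i j c e hc he hn =>
    rw [formMul_tmul hx hc]
    refine Submodule.smul_mem _ _ ?_
    have := smul_mem_tensor_deg hc (Grading.assoc_mem_deg _ _ _
      (Grading.tmul_mem (((CSym.grading (Grading.dual ℒ)).tensor gF)) gE hx he rfl))
    rwa [show i + (k + j) = k + l by omega] at this

end Products

/-! ### Connections, flatness and tensor products -/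

section Connection

theorem neg_one_zpow_succ_smul_add {K M : Type*} [Field K] [AddCommGroup M] [Module K M] (i : ℤ)
    (x : M) : ((-1 : K) ^ (i + 1)) • x + ((-1 : K) ^ i) • x = 0 := by
  rw [zpow_add_one₀ (by simp), mul_neg_one, neg_smul, neg_add_cancel]

variable {K : Type*} [Field K] {L : Type*} [AddCommGroup L] [Module K L]
  {ℒ : ℤ → Submodule K L} [DirectSum.Decomposition ℒ] (S : SHLieAlgebra ℒ)
  {F E : Type*} [AddCommGroup F] [Module K F] [AddCommGroup E] [Module K E]

theorem SHLieAlgebra.Q_one : S.Q 1 = 0 := by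
  have h := S.leibniz 0 1 1 CSym.one_mem_deg
  simpa using h

theorem connection_one_tmul (D : F →ₗ[K] O ℒ ⊗[K] F) (f : F) :
    connection S.Q D (1 ⊗ₜ f) = D f := by
  rw [connection_tmul _ _ CSym.one_mem_deg, S.Q_one]
  simp

/-- Only `a` has to be homogeneous: the sign in `connection` comes from the parity operator, which
is an algebra homomorphism. -/
theorem connection_smul (D : F →ₗ[K] O ℒ ⊗[K] F) {n : ℤ} {a : O ℒ}
    (ha : a ∈ (CSym.grading (Grading.dual ℒ)).deg n) (x : O ℒ ⊗[K] F) :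
    connection S.Q D (a • x) = S.Q a • x + ((-1 : K) ^ n) • a • connection S.Q D x := by
  induction x with
  | zero => simp
  | add x y hx hy => simp only [smul_add, map_add, hx, hy]; abel
  | tmul b f =>
    have hs : (CSym.grading (Grading.dual ℒ)).sgn (a * b) =
        ((-1 : K) ^ n) • (a * (CSym.grading (Grading.dual ℒ)).sgn b) := by
      change CSym.sgn _ (a * b) = _
      have : CSym.sgn (Grading.dual ℒ) a = ((-1 : K) ^ n) • a :=
        (CSym.grading (Grading.dual ℒ)).sgn_apply n a ha
      rw [map_mul, this, smul_mul_assoc]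
      rfl
    have hc (c : O ℒ) : connection S.Q D (c ⊗ₜ f) =
        S.Q c ⊗ₜ f + (CSym.grading (Grading.dual ℒ)).sgn c • D f := rfl
    rw [smul_tmul_form, hc, hc, hs, S.leibniz n a b ha, TensorProduct.add_tmul, smul_add, smul_add,
      smul_tmul_form, smul_tmul_form, TensorProduct.smul_tmul', ← mul_smul, ← add_assoc,
      smul_assoc]

theorem connection_mem_deg {gF : Grading K F} {D : F →ₗ[K] O ℒ ⊗[K] F}
    (hD : ∀ n, ∀ f ∈ gF.deg n,
      D f ∈ ((CSym.grading (Grading.dual ℒ)).tensor gF).deg (n + 1)) {n : ℤ} {x : O ℒ ⊗[K] F}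
    (hx : x ∈ ((CSym.grading (Grading.dual ℒ)).tensor gF).deg n) :
    connection S.Q D x ∈ ((CSym.grading (Grading.dual ℒ)).tensor gF).deg (n + 1) := by
  induction hx using Grading.tensor_induction with
  | zero => rw [map_zero]; exact zero_mem _
  | add x y _ _ hx hy => rw [map_add]; exact add_mem hx hy
  | tmul i j a f ha hf hn =>
    rw [connection_tmul _ _ ha]
    refine add_mem (Grading.tmul_mem _ _ (S.degree_one _ _ ha) hf (by omega))
      (Submodule.smul_mem _ _ ?_)
    have := smul_mem_tensor_deg ha (hD j f hf)
    rwa [show i + (j + 1) = n + 1 by omega] at this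

/-- Since $D(f) = \nabla(1\otimes f)$, the hypothesis says that $\nabla^2$ vanishes on constants.
This is enough, because $\nabla^2$ is linear over forms: the two cross terms $Q(a)\cdot D(f)$ carry
opposite signs, and $Q^2 = 0$. -/
theorem connection_connection {gF : Grading K F} {D : F →ₗ[K] O ℒ ⊗[K] F}
    (hD : ∀ n, ∀ f ∈ gF.deg n, connection S.Q D (D f) = 0) {n : ℤ} {x : O ℒ ⊗[K] F}
    (hx : x ∈ ((CSym.grading (Grading.dual ℒ)).tensor gF).deg n) :
    connection S.Q D (connection S.Q D x) = 0 := by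
  induction hx using Grading.tensor_induction with
  | zero => simp
  | add x y _ _ hx hy => rw [map_add, map_add, hx, hy, add_zero]
  | tmul i j a f ha hf hn =>
    rw [connection_tmul _ _ ha, map_add, map_smul, connection_tmul _ _ (S.degree_one _ _ ha),
      connection_smul S D ha, hD j f hf, S.square_zero, TensorProduct.zero_tmul,
      zero_add, smul_zero, smul_zero, add_zero]
    exact neg_one_zpow_succ_smul_add i _

variable {gF : Grading K F} {gE : Grading K E} {DF : F →ₗ[K] O ℒ ⊗[K] F}
  {DE : E →ₗ[K] O ℒ ⊗[K] E}

theorem tensorD_tmul {n : ℤ} {f : F} (hf : f ∈ gF.deg n) (e : E) :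
    tensorD gF DF DE (f ⊗ₜ e) = TensorProduct.assoc K (O ℒ) F E (DF f ⊗ₜ e) +
      ((-1 : K) ^ n) • formMul gF (1 ⊗ₜ f) (DE e) := by
  rw [formMul_tmul_apply, one_smul, ← LinearMap.smul_apply, ← map_smul, ← gF.sgn_apply n f hf]
  rfl

variable [CharZero K]

theorem tensorD_mem_deg
    (hDF : ∀ n, ∀ f ∈ gF.deg n, DF f ∈ ((CSym.grading (Grading.dual ℒ)).tensor gF).deg (n + 1))
    (hDE : ∀ n, ∀ e ∈ gE.deg n, DE e ∈ ((CSym.grading (Grading.dual ℒ)).tensor gE).deg (n + 1))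
    {n : ℤ} {x : F ⊗[K] E} (hx : x ∈ (gF.tensor gE).deg n) : tensorD gF DF DE x ∈
      ((CSym.grading (Grading.dual ℒ)).tensor (gF.tensor gE)).deg (n + 1) := by
  induction hx using Grading.tensor_induction with
  | zero => rw [map_zero]; exact zero_mem _
  | add x y _ _ hx hy => rw [map_add]; exact add_mem hx hy
  | tmul i j f e hf he hn =>
    rw [tensorD_tmul hf]
    refine add_mem (Grading.assoc_mem_deg _ _ _ (Grading.tmul_mem
      ((CSym.grading (Grading.dual ℒ)).tensor gF) gE (hDF i f hf) he (by omega)))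
      (Submodule.smul_mem _ _ ?_)
    have := formMul_mem_deg (Grading.tmul_mem _ gF CSym.one_mem_deg hf (zero_add i)) (hDE j e he)
    rwa [← hn, add_assoc]

/-- The Leibniz rule for the product of forms. -/
theorem connection_formMul
    (hDF : ∀ n, ∀ f ∈ gF.deg n, DF f ∈ ((CSym.grading (Grading.dual ℒ)).tensor gF).deg (n + 1))
    (hDE : ∀ n, ∀ e ∈ gE.deg n, DE e ∈ ((CSym.grading (Grading.dual ℒ)).tensor gE).deg (n + 1))
    {k l : ℤ} {x : O ℒ ⊗[K] F} {y : O ℒ ⊗[K] E}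
    (hx : x ∈ ((CSym.grading (Grading.dual ℒ)).tensor gF).deg k)
    (hy : y ∈ ((CSym.grading (Grading.dual ℒ)).tensor gE).deg l) :
    connection S.Q (tensorD gF DF DE) (formMul gF x y) =
      formMul gF (connection S.Q DF x) y + ((-1 : K) ^ k) • formMul gF x (connection S.Q DE y) := by
  induction hx using Grading.tensor_induction with
  | zero => simp
  | add x x' _ _ hx hx' => simp only [map_add, LinearMap.add_apply, hx, hx', smul_add]; abel
  | tmul i j a f ha hf hn =>
  induction hy using Grading.tensor_induction with
  | zero => simp
  | add y y' _ _ hy hy' => simp only [map_add, hy, hy', smul_add]; abel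
  | tmul p q b e hb he hl =>
    have h1 := Grading.tmul_mem (CSym.grading (Grading.dual ℒ)) gF CSym.one_mem_deg hf (zero_add j)
    have hins : formMul gF (a ⊗ₜ f) (b • DE e) =
        ((-1 : K) ^ (j * p)) • (a * b) • formMul gF (1 ⊗ₜ f) (DE e) := by
      have := formMul_smul_of_mem h1 hb (hDE q e he)
      rw [formMul_tmul_apply, one_smul] at this
      rw [formMul_tmul_apply, this, smul_comm a, mul_smul]
    rw [formMul_tmul_tmul hf hb, map_smul, connection_tmul _ _ (CSym.mul_mem_deg ha hb),
      tensorD_tmul hf, S.leibniz i a b ha, connection_tmul _ _ ha, connection_tmul _ _ hb,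
      map_add, LinearMap.add_apply, map_smul, LinearMap.smul_apply, smul_formMul,
      formMul_tmul_tmul hf hb, formMul_tmul (hDF j f hf) hb, map_add, map_smul,
      formMul_tmul_tmul hf (S.degree_one _ _ hb), hins, smul_comm a, ← mul_smul a b,
      TensorProduct.add_tmul, ← TensorProduct.smul_tmul', smul_add (a * b), smul_comm (a * b)]
    simp only [smul_add]
    repeat rw [smul_smul ((-1 : K) ^ _) ((-1 : K) ^ _), neg_one_zpow_mul]
    -- The exponents on the two sides agree modulo $2$ because $k = i + j$.
    rw [neg_one_zpow_congr (a := k + j * (p + 1)) (b := j * p + i) (by grind),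
      neg_one_zpow_congr (a := i + (j + 1) * p) (b := j * p + (i + p)) (by grind),
      neg_one_zpow_congr (a := k + p + j * p) (b := j * p + (i + p) + j) (by grind)]
    abel

/-- A tensor product of flat connections is flat. -/
theorem connection_tensorD
    (hDF : ∀ n, ∀ f ∈ gF.deg n, DF f ∈ ((CSym.grading (Grading.dual ℒ)).tensor gF).deg (n + 1))
    (hDE : ∀ n, ∀ e ∈ gE.deg n, DE e ∈ ((CSym.grading (Grading.dual ℒ)).tensor gE).deg (n + 1))
    (hF : ∀ n, ∀ f ∈ gF.deg n, connection S.Q DF (DF f) = 0)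
    (hE : ∀ n, ∀ e ∈ gE.deg n, connection S.Q DE (DE e) = 0)
    {n : ℤ} {x : F ⊗[K] E} (hx : x ∈ (gF.tensor gE).deg n) :
    connection S.Q (tensorD gF DF DE) (tensorD gF DF DE x) = 0 := by
  induction hx using Grading.tensor_induction with
  | zero => simp
  | add x y _ _ hx hy => simp only [map_add, hx, hy, add_zero]
  | tmul i j f e hf he hn =>
    have h1 := Grading.tmul_mem (CSym.grading (Grading.dual ℒ)) gF CSym.one_mem_deg hf (zero_add i)
    have h2 := Grading.tmul_mem (CSym.grading (Grading.dual ℒ)) gE CSym.one_mem_deg he (zero_add j)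
    -- With $D(f\otimes e)$ written as $D_F f\cdot(1\otimes e) \pm (1\otimes f)\cdot D_E e$, the
    -- Leibniz rule and the flatness of both factors leave only $D_F f\cdot D_E e$, twice and with
    -- opposite signs.
    rw [tensorD_tmul hf, ← formMul_one_tmul (hDF i f hf), map_add, map_smul,
      connection_formMul S hDF hDE (hDF i f hf) h2, connection_formMul S hDF hDE h1 (hDE j e he),
      hF i f hf, hE j e he, connection_one_tmul, connection_one_tmul, map_zero, map_zero,
      LinearMap.zero_apply, zero_add, smul_zero, add_zero]
    exact neg_one_zpow_succ_smul_add i _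

end Connection

/-! ### Functoriality of connections in the coefficients -/

section Naturality

variable {K : Type*} [Field K] {L : Type*} [AddCommGroup L] [Module K L]
  {ℒ : ℤ → Submodule K L} [DirectSum.Decomposition ℒ]
  {F F' E : Type*} [AddCommGroup F] [Module K F] [AddCommGroup F'] [Module K F']
  [AddCommGroup E] [Module K E]

theorem connection_lTensor (Q : O ℒ →ₗ[K] O ℒ) {D : F →ₗ[K] O ℒ ⊗[K] F}
    {D' : F' →ₗ[K] O ℒ ⊗[K] F'} {p : F →ₗ[K] F'} (hp : ∀ f, p.lTensor (O ℒ) (D f) = D' (p f))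
    (x : O ℒ ⊗[K] F) :
    p.lTensor (O ℒ) (connection Q D x) = connection Q D' (p.lTensor (O ℒ) x) := by
  have hs (a : O ℒ) (y : O ℒ ⊗[K] F) : p.lTensor (O ℒ) (a • y) = a • p.lTensor (O ℒ) y := by
    induction y with
    | zero => simp
    | add y z hy hz => simp only [smul_add, map_add, hy, hz]
    | tmul b f => simp only [smul_tmul_form, LinearMap.lTensor_tmul]
  induction x with
  | zero => simp
  | add x y hx hy => simp only [map_add, hx, hy]
  | tmul a f =>
    have hc (c : O ℒ) : connection Q D (c ⊗ₜ f) =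
        Q c ⊗ₜ f + (CSym.grading (Grading.dual ℒ)).sgn c • D f := rfl
    have hc' (c : O ℒ) (f') : connection Q D' (c ⊗ₜ f') =
        Q c ⊗ₜ f' + (CSym.grading (Grading.dual ℒ)).sgn c • D' f' := rfl
    rw [hc, LinearMap.lTensor_tmul, hc', map_add, hs, hp, LinearMap.lTensor_tmul]

/-- Compatibility with the parity operators enters because `insertLeft` splits its argument into
even and odd parts in order to produce the Koszul sign. -/
theorem tensorD_rTensor {gF : Grading K F} {gF' : Grading K F'} {DF : F →ₗ[K] O ℒ ⊗[K] F}
    {DF' : F' →ₗ[K] O ℒ ⊗[K] F'} (DE : E →ₗ[K] O ℒ ⊗[K] E) {p : F →ₗ[K] F'}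
    (hp : ∀ f, p.lTensor (O ℒ) (DF f) = DF' (p f)) (hs : ∀ f, p (gF.sgn f) = gF'.sgn (p f))
    (x : F ⊗[K] E) : (p.rTensor E).lTensor (O ℒ) (tensorD gF DF DE x) =
      tensorD gF' DF' DE (p.rTensor E x) := by
  have ha (y : O ℒ ⊗[K] F) (e : E) :
      (p.rTensor E).lTensor (O ℒ) (TensorProduct.assoc K (O ℒ) F E (y ⊗ₜ e)) =
        TensorProduct.assoc K (O ℒ) F' E (p.lTensor (O ℒ) y ⊗ₜ e) := by
    induction y with
    | zero => simp
    | add y z hy hz => simp only [TensorProduct.add_tmul, map_add, hy, hz]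
    | tmul b f => simp
  have hi (f : F) (y : O ℒ ⊗[K] E) : (p.rTensor E).lTensor (O ℒ) (insertLeft gF f y) =
      insertLeft gF' (p f) y := by
    induction y with
    | zero => simp
    | add y z hy hz => simp only [map_add, hy, hz]
    | tmul b e => simp [insertLeft, Grading.even, Grading.odd, hs]
  induction x with
  | zero => simp
  | add x y hx hy => simp only [map_add, hx, hy]
  | tmul f e =>
    have h1 : tensorD gF DF DE (f ⊗ₜ e) = TensorProduct.assoc K (O ℒ) F E (DF f ⊗ₜ e) +
      insertLeft gF (gF.sgn f) (DE e) := rfl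
    have h2 (f') : tensorD gF' DF' DE (f' ⊗ₜ e) = TensorProduct.assoc K (O ℒ) F' E (DF' f' ⊗ₜ e) +
      insertLeft gF' (gF'.sgn f') (DE e) := rfl
    rw [h1, LinearMap.rTensor_tmul, h2, map_add, ha, hi, hp, hs]

end Naturality

/-! ### The graded algebra of endomorphism-valued forms -/

section Endomorphisms

variable {K : Type*} [Field K] {L : Type*} [AddCommGroup L] [Module K L]
  {ℒ : ℤ → Submodule K L} [DirectSum.Decomposition ℒ]
  {E : Type*} [AddCommGroup E] [Module K E] (ℰ : ℤ → Submodule K E) [DirectSum.Decomposition ℰ]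

/-- The graded product of `𝒪(L) ⊗ End(E)` as a bilinear map. -/
noncomputable def gradedMulHom : O ℒ ⊗[K] Module.End K E →ₗ[K] O ℒ ⊗[K] Module.End K E →ₗ[K]
    O ℒ ⊗[K] Module.End K E :=
  LinearMap.mk₂ K (gradedMul ℰ)
    (fun x x' y => by simp only [gradedMul, map_add, add_mul]; abel)
    (fun r x y => by simp only [gradedMul, map_smul, smul_mul_assoc, smul_add])
    (fun x y y' => by simp only [gradedMul, map_add, mul_add]; abel)
    (fun r x y => by simp only [gradedMul, map_smul, mul_smul_comm, smul_add])

theorem gradedMulHom_apply (x y : O ℒ ⊗[K] Module.End K E) :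
    gradedMulHom ℰ x y = gradedMul ℰ x y := rfl

variable {ℰ}

theorem mul_mem_endo_deg {m n : ℤ} {φ ψ : Module.End K E} (hφ : φ ∈ (Grading.endo ℰ).deg m)
    (hψ : ψ ∈ (Grading.endo ℰ).deg n) : φ * ψ ∈ (Grading.endo ℰ).deg (m + n) := by
  intro p v hv
  rw [add_comm m, ← add_assoc]
  exact hφ _ _ (hψ p v hv)

theorem endD_apply (D : O ℒ ⊗[K] Module.End K E) (φ : Module.End K E) :
    endD ℰ D φ = (gradedCommutator ℰ φ).lTensor (O ℒ) D := rfl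

variable [CharZero K]

theorem gradedMulHom_tmul {m n : ℤ} {φ ψ : Module.End K E} {ω η : O ℒ}
    (hφ : φ ∈ (Grading.endo ℰ).deg m) (hη : η ∈ (CSym.grading _).deg n) :
    gradedMulHom ℰ (ω ⊗ₜ[K] φ) (η ⊗ₜ[K] ψ) =
      ((-1 : K) ^ (m * n)) • ((ω * η) ⊗ₜ[K] (φ * ψ)) :=
  gradedMul_tmul ℰ hφ hη

theorem gradedMulHom_assoc {k l n : ℤ} {x y z : O ℒ ⊗[K] Module.End K E}
    (hx : x ∈ ((CSym.grading (Grading.dual ℒ)).tensor (Grading.endo ℰ)).deg k)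
    (hy : y ∈ ((CSym.grading (Grading.dual ℒ)).tensor (Grading.endo ℰ)).deg l)
    (hz : z ∈ ((CSym.grading (Grading.dual ℒ)).tensor (Grading.endo ℰ)).deg n) :
    gradedMulHom ℰ (gradedMulHom ℰ x y) z = gradedMulHom ℰ x (gradedMulHom ℰ y z) := by
  induction hx using Grading.tensor_induction with
  | zero => simp
  | add x x' _ _ hx hx' => simp only [map_add, LinearMap.add_apply, hx, hx']
  | tmul i j a φ ha hφ hk =>
  induction hy using Grading.tensor_induction with
  | zero => simp
  | add y y' _ _ hy hy' => simp only [map_add, LinearMap.add_apply, hy, hy']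
  | tmul i' j' b ψ hb hψ hl =>
  induction hz using Grading.tensor_induction with
  | zero => simp
  | add z z' _ _ hz hz' => simp only [map_add, hz, hz']
  | tmul i'' j'' c χ hc hχ hn =>
    rw [gradedMulHom_tmul hφ hb, gradedMulHom_tmul hψ hc, map_smul, map_smul, LinearMap.smul_apply,
      gradedMulHom_tmul (mul_mem_endo_deg hφ hψ) hc,
      gradedMulHom_tmul hφ (CSym.mul_mem_deg hb hc), mul_assoc, mul_assoc]
    rw [smul_smul, smul_smul, neg_one_zpow_mul, neg_one_zpow_mul]
    congr 2
    ring

/-- $Q\otimes 1$ is a derivation for the total degree: $Q$ raises the degree of `b` by one, so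
moving `φ` past it costs an extra $(-1)^{|\varphi|}$, and this turns $(-1)^{|a|}$ into $(-1)^k$. -/
theorem rTensor_gradedMulHom (S : SHLieAlgebra ℒ) {k l : ℤ} {x y : O ℒ ⊗[K] Module.End K E}
    (hx : x ∈ ((CSym.grading (Grading.dual ℒ)).tensor (Grading.endo ℰ)).deg k)
    (hy : y ∈ ((CSym.grading (Grading.dual ℒ)).tensor (Grading.endo ℰ)).deg l) :
    S.Q.rTensor _ (gradedMulHom ℰ x y) = gradedMulHom ℰ (S.Q.rTensor _ x) y +
      ((-1 : K) ^ k) • gradedMulHom ℰ x (S.Q.rTensor _ y) := by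
  induction hx using Grading.tensor_induction with
  | zero => simp
  | add x x' _ _ hx hx' => simp only [map_add, LinearMap.add_apply, hx, hx', smul_add]; abel
  | tmul i j a φ ha hφ hk =>
  induction hy using Grading.tensor_induction with
  | zero => simp
  | add y y' _ _ hy hy' => simp only [map_add, hy, hy', smul_add]; abel
  | tmul i' j' b ψ hb hψ hl =>
    rw [gradedMulHom_tmul hφ hb, map_smul, LinearMap.rTensor_tmul, LinearMap.rTensor_tmul,
      LinearMap.rTensor_tmul, gradedMulHom_tmul hφ hb, gradedMulHom_tmul hφ (S.degree_one _ _ hb),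
      S.leibniz i a b ha, TensorProduct.add_tmul, smul_add, ← TensorProduct.smul_tmul']
    rw [smul_smul, smul_smul, neg_one_zpow_mul, neg_one_zpow_mul]
    congr 2
    exact neg_one_zpow_congr (by grind)

theorem endD_mem_deg {n : ℤ} {D : O ℒ ⊗[K] Module.End K E} {φ : Module.End K E}
    (hD : D ∈ ((CSym.grading (Grading.dual ℒ)).tensor (Grading.endo ℰ)).deg 1)
    (hφ : φ ∈ (Grading.endo ℰ).deg n) :
    endD ℰ D φ ∈ ((CSym.grading (Grading.dual ℒ)).tensor (Grading.endo ℰ)).deg (n + 1) := by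
  rw [endD_apply]
  refine Grading.map_mem_deg _ _ (fun i j a ψ hij ha hψ => ?_) hD
  rw [LinearMap.lTensor_tmul, gradedCommutator_apply ℰ hφ hψ]
  refine Grading.tmul_mem _ _ (j := j + n) ha (sub_mem (mul_mem_endo_deg hψ hφ)
    (Submodule.smul_mem _ _ ?_)) (by omega)
  rw [add_comm]
  exact mul_mem_endo_deg hφ hψ

/-- The induced connection on $\operatorname{End}(E)$ is $Q + [D,-]$ in the graded algebra of
endomorphism-valued forms. Flatness is thereby reduced to associativity and the derivation property
of $Q$. -/
theorem connection_endD (S : SHLieAlgebra ℒ) {D y : O ℒ ⊗[K] Module.End K E} {n : ℤ}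
    (hD : D ∈ ((CSym.grading (Grading.dual ℒ)).tensor (Grading.endo ℰ)).deg 1)
    (hy : y ∈ ((CSym.grading (Grading.dual ℒ)).tensor (Grading.endo ℰ)).deg n) :
    connection S.Q (endD ℰ D) y = S.Q.rTensor _ y + (gradedMulHom ℰ D y -
      ((-1 : K) ^ n) • gradedMulHom ℰ y D) := by
  induction hy using Grading.tensor_induction with
  | zero => simp
  | add y y' _ _ hy hy' => simp only [map_add, LinearMap.add_apply, hy, hy', smul_add]; abel
  | tmul p q b φ hb hφ hn =>
    rw [connection_tmul _ _ hb, LinearMap.rTensor_tmul, endD_apply]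
    congr 1
    induction hD using Grading.tensor_induction with
    | zero => simp
    | add D D' _ _ hD hD' => simp only [map_add, LinearMap.add_apply, smul_add, hD, hD']; abel
    | tmul i j η ψ hη hψ hij =>
      rw [LinearMap.lTensor_tmul, gradedCommutator_apply ℰ hφ hψ, smul_tmul_form,
        gradedMulHom_tmul hψ hb, gradedMulHom_tmul hφ hη, CSym.mul_comm_deg hη hb,
        TensorProduct.tmul_sub, TensorProduct.tmul_smul, ← TensorProduct.smul_tmul', smul_sub]
      rw [smul_smul, smul_smul, smul_smul, neg_one_zpow_mul, neg_one_zpow_mul, neg_one_zpow_mul,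
        neg_one_zpow_congr (a := j * p + i * p) (b := p) (by grind),
        -- This comparison uses that `D` has total degree one, that is, $i = 1 - j$.
        neg_one_zpow_congr (a := n + q * i) (b := p + q * j) (by
          rw [← Int.even_sub]
          exact ⟨q - q * j, by rw [← hn, show i = 1 - j by omega]; ring⟩)]

/-- The connection induced on `End(E)` by a flat connection is flat. -/
theorem connection_endD_endD (S : SHLieAlgebra ℒ) {D : O ℒ ⊗[K] Module.End K E}
    (hD : D ∈ ((CSym.grading (Grading.dual ℒ)).tensor (Grading.endo ℰ)).deg 1)
    (hflat : curvature ℰ S.Q D = 0) {n : ℤ} {φ : Module.End K E}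
    (hφ : φ ∈ (Grading.endo ℰ).deg n) : connection S.Q (endD ℰ D) (endD ℰ D φ) = 0 := by
  have h1 := Grading.tmul_mem (CSym.grading (Grading.dual ℒ)) (Grading.endo ℰ) CSym.one_mem_deg hφ
    (zero_add n)
  have hQ1 : S.Q.rTensor (Module.End K E) (1 ⊗ₜ φ) = 0 := by
    rw [LinearMap.rTensor_tmul, S.Q_one, TensorProduct.zero_tmul]
  have hQD : S.Q.rTensor (Module.End K E) D = -gradedMulHom ℰ D D :=
    eq_neg_of_add_eq_zero_left hflat
  -- Since $Q(1)=0$, the value at `φ` is the commutator $[D, 1\otimes\varphi]$. What follows is the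
  -- computation $Q[D,\varphi] + [D,[D,\varphi]] = [Q(D) + D^2,\varphi] = 0$.
  have he : endD ℰ D φ = gradedMulHom ℰ D (1 ⊗ₜ φ) -
      ((-1 : K) ^ n) • gradedMulHom ℰ (1 ⊗ₜ φ) D := by
    rw [← connection_one_tmul S, connection_endD S hD h1, hQ1, zero_add]
  rw [connection_endD S hD (endD_mem_deg hD hφ), he]
  simp only [map_sub, map_smul, LinearMap.sub_apply, LinearMap.smul_apply,
    rTensor_gradedMulHom S hD h1, rTensor_gradedMulHom S h1 hD, hQ1, hQD, map_neg, map_zero,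
    LinearMap.neg_apply, LinearMap.zero_apply, gradedMulHom_assoc hD hD h1,
    gradedMulHom_assoc hD h1 hD, gradedMulHom_assoc h1 hD hD]
  -- After reassociation only the words $DD\varphi$, $D\varphi D$ and $\varphi DD$ occur, and the
  -- coefficient of each is zero.
  generalize gradedMulHom ℰ D (gradedMulHom ℰ D (1 ⊗ₜ φ)) = X
  generalize gradedMulHom ℰ D (gradedMulHom ℰ (1 ⊗ₜ φ) D) = Y
  generalize gradedMulHom ℰ (1 ⊗ₜ φ) (gradedMulHom ℰ D D) = Z
  rw [zpow_add_one₀ (by simp)]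
  module

end Endomorphisms

/-! ### The de Rham operator in a homogeneous basis -/

section Forms

variable {K : Type*} [Field K] {V : Type*} [AddCommGroup V] [Module K V]

/-- The dual basis is a finite homogeneous spanning family of linear forms, with degrees $-m_i$;
this is the hypothesis `hspan` of the expansion and vanishing results for power series. -/
theorem dual_exists_sum_coord {𝒱 : ℤ → Submodule K V}
    [DirectSum.Decomposition 𝒱] {k : ℕ} {b : Module.Basis (Fin k) K V} {m : Fin k → ℤ}
    (hb : ∀ i, b i ∈ 𝒱 (m i)) (d : ℤ) (ξ : Module.Dual K V) (hξ : ξ ∈ (Grading.dual 𝒱).deg d) :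
    ∃ a : Fin k → K, (∀ i, -m i ≠ d → a i = 0) ∧ ξ = ∑ i, a i • b.coord i :=
  ⟨fun i => ξ (b i), fun i hi => hξ _ (by omega) _ (hb i), b.ext fun i => by
    simp⟩

theorem contraction_mem_deg [CharZero K] {𝒱 : ℤ → Submodule K V}
    [DirectSum.Decomposition 𝒱] {n m : ℤ} {ω : O 𝒱} {v : V}
    (hω : ω ∈ (CSym.grading (Grading.dual 𝒱)).deg n) (hv : v ∈ 𝒱 m) :
    contraction 𝒱 ω v ∈ (CSym.grading (Grading.dual 𝒱)).deg (n + m) :=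
  CSym.contr_mem_deg (g := Grading.dual 𝒱) (fun k hk ξ hξ => hξ m (by omega) v hv) hω

variable [FiniteDimensional K V]

theorem formEquiv_smul {R : Type*} [Ring R] [Algebra K R] (r : R)
    (x : R ⊗[K] Module.Dual K V) (v : V) : formEquiv R V (r • x) v = r * formEquiv R V x v := by
  induction x with
  | zero => simp
  | add x y hx hy => simp only [smul_add, map_add, LinearMap.add_apply, hx, hy, mul_add]
  | tmul s ξ => rw [TensorProduct.smul_tmul', formEquiv_tmul, formEquiv_tmul, smul_eq_mul, mul_smul_comm]

variable [CharZero K] {𝒱 : ℤ → Submodule K V} [DirectSum.Decomposition 𝒱]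

theorem deRham_eq_sum {k : ℕ} (b : Module.Basis (Fin k) K V) (ω : O 𝒱) :
    deRham 𝒱 ω = ∑ i, contraction 𝒱 ω (b i) ⊗ₜ[K] b.coord i := by
  refine (formEquiv (O 𝒱) V).injective (b.ext fun i => ?_)
  rw [deRham, LinearMap.comp_apply, LinearEquiv.coe_coe, LinearEquiv.apply_symm_apply, map_sum,
    LinearMap.sum_apply, Finset.sum_eq_single i]
  · simp
  · intro l _ hl
    simp [Finsupp.single_eq_of_ne hl]
  · simp

end Forms

/-! ### The operator $J$ and the differential of the jet form -/

namespace SHLiePair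

variable {K : Type*} [Field K] [CharZero K]
  {L A E : Type*} [AddCommGroup L] [Module K L] [FiniteDimensional K L]
  [AddCommGroup A] [Module K A] [FiniteDimensional K A] [AddCommGroup E] [Module K E]
  {ℒ : ℤ → Submodule K L} [DirectSum.Decomposition ℒ]
  {𝒜 : ℤ → Submodule K A} [DirectSum.Decomposition 𝒜]
  {ℰ : ℤ → Submodule K E} [DirectSum.Decomposition ℰ]
  (P : SHLiePair ℒ 𝒜)

set_option linter.unusedSectionVars false

theorem res_mem_deg {n : ℤ} {ω : O ℒ} (hω : ω ∈ (CSym.grading (Grading.dual ℒ)).deg n) :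
    P.res ω ∈ (CSym.grading (Grading.dual 𝒜)).deg n :=
  CSym.map_mem_deg _ _ hω

theorem res_Q (ω : O ℒ) : P.res (P.big.Q ω) = P.small.Q (P.res ω) := P.subalgebra ω

theorem J_eq_sum {k : ℕ} (b : Module.Basis (Fin k) K L) (ω : O ℒ) :
    P.J ω = ∑ i, P.res (contraction ℒ ω (b i)) ⊗ₜ[K] b.coord i := by
  rw [J, LinearMap.comp_apply, deRham_eq_sum b, map_sum]
  rfl

theorem J_mem_deg {n : ℤ} {ω : O ℒ} (hω : ω ∈ (CSym.grading (Grading.dual ℒ)).deg n) :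
    P.J ω ∈ ((CSym.grading (Grading.dual 𝒜)).tensor (Grading.dual ℒ)).deg n := by
  obtain ⟨k, b, m, hb⟩ := exists_homogeneous_basis ℒ
  rw [P.J_eq_sum b]
  exact sum_mem fun i _ => Grading.tmul_mem _ _ (P.res_mem_deg (contraction_mem_deg hω (hb i)))
    (coord_mem_dual_deg hb i) (by omega)

/-- The graded Leibniz rule for `J`. -/
theorem J_mul {p q : ℤ} {α β : O ℒ} (hα : α ∈ (CSym.grading (Grading.dual ℒ)).deg p)
    (hβ : β ∈ (CSym.grading (Grading.dual ℒ)).deg q) :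
    P.J (α * β) = P.res α • P.J β + ((-1 : K) ^ (p * q)) • P.res β • P.J α := by
  obtain ⟨k, b, m, hb⟩ := exists_homogeneous_basis ℒ
  simp only [P.J_eq_sum b, Finset.smul_sum, ← Finset.sum_add_distrib]
  refine Finset.sum_congr rfl fun i _ => ?_
  have h : contraction ℒ (α * β) (b i) = α * contraction ℒ β (b i) +
      ((-1 : K) ^ (p * q)) • (β * contraction ℒ α (b i)) := CSym.contr_mul _ hα hβ
  rw [h, map_add, map_smul, map_mul, map_mul, TensorProduct.add_tmul,
    ← TensorProduct.smul_tmul', smul_tmul_form, smul_tmul_form]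

theorem J_one : P.J 1 = 0 := by
  have h := P.J_mul CSym.one_mem_deg CSym.one_mem_deg
  simpa using h

theorem J_ι {m : ℤ} {ξ : Module.Dual K L} (hξ : ξ ∈ (Grading.dual ℒ).deg m) :
    P.J (CSym.ι _ ξ) = 1 ⊗ₜ ξ := by
  obtain ⟨k, b, -, -⟩ := exists_homogeneous_basis ℒ
  have h (v : L) : contraction ℒ (CSym.ι _ ξ) v = algebraMap K _ (ξ v) := CSym.contr_ι _ hξ
  rw [P.J_eq_sum b]
  simp only [h, Algebra.algebraMap_eq_smul_one, map_smul, map_one, TensorProduct.smul_tmul]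
  rw [← TensorProduct.tmul_sum]
  congr 1
  exact b.ext fun i => by simp

theorem ambientD_mem_deg (n : ℤ) (ξ : Module.Dual K L) (hξ : ξ ∈ (Grading.dual ℒ).deg n) :
    P.ambientD ξ ∈ ((CSym.grading (Grading.dual 𝒜)).tensor (Grading.dual ℒ)).deg (n + 1) :=
  P.J_mem_deg (P.big.degree_one _ _ (CSym.ι_mem_deg hξ))

/-- `J ∘ Q_L = (Q_A + D^{L^∨}) ∘ J`. -/
theorem J_Q {n : ℤ} {ω : O ℒ} (hω : ω ∈ (CSym.grading (Grading.dual ℒ)).deg n) :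
    P.J (P.big.Q ω) = connection P.small.Q P.ambientD (P.J ω) := by
  obtain ⟨k, b, m, hb⟩ := exists_homogeneous_basis ℒ
  rw [← sub_eq_zero]
  -- `Δ` is the defect of the intertwining relation.
  let Δ : O ℒ →ₗ[K] O 𝒜 ⊗[K] Module.Dual K L :=
    P.J ∘ₗ P.big.Q - connection P.small.Q P.ambientD ∘ₗ P.J
  have hΔ (x : O ℒ) : Δ x = P.J (P.big.Q x) - connection P.small.Q P.ambientD (P.J x) := rfl
  -- Both terms of `Δ` expand by the Leibniz rules. The part proportional to `P.res x` is the defect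
  -- at `ξ` itself, which is zero because $J(\xi) = 1\otimes\xi$ and $D^{L^\vee}(\xi) = J(Q_L\xi)$.
  have hmul {p d : ℤ} {ξ : Module.Dual K L} {x : O ℒ} (hξ : ξ ∈ (Grading.dual ℒ).deg p)
      (hx : x ∈ (CSym.grading (Grading.dual ℒ)).deg d) :
      Δ (CSym.ι _ ξ * x) = ((-1 : K) ^ p) • P.res (CSym.ι _ ξ) • Δ x := by
    have hX := CSym.ι_mem_deg hξ
    have hD : P.ambientD ξ = P.J (P.big.Q (CSym.ι _ ξ)) := rfl
    rw [hΔ, hΔ, P.big.leibniz p _ _ hX, map_add, map_smul, P.J_mul (P.big.degree_one _ _ hX) hx,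
      P.J_mul hX (P.big.degree_one _ _ hx), P.J_mul hX hx, map_add,
      map_smul (connection P.small.Q P.ambientD) ((-1 : K) ^ _), connection_smul _ _ (P.res_mem_deg hX), connection_smul _ _ (P.res_mem_deg hx), P.J_ι hξ,
      connection_one_tmul, hD, res_Q, res_Q, smul_sub, smul_sub, smul_add, smul_add]
    rw [smul_smul, smul_smul, neg_one_zpow_mul, neg_one_zpow_mul,
      neg_one_zpow_congr (a := p + p * (d + 1)) (b := p * d) (by grind),
      show (p + 1) * d = p * d + d by ring]
    abel
  refine (formEquiv (O 𝒜) L).injective (LinearMap.ext fun l => ?_)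
  rw [map_zero, LinearMap.zero_apply, ← hΔ]
  -- The vanishing criterion is for maps with values in power series, hence the component of `Δ`
  -- along a fixed `l`. The multiplier `u` is, up to sign, the restriction of a linear form, so it
  -- has no constant term.
  refine CSym.eq_zero_of_ι_mul (dual_exists_sum_coord hb)
    (LinearMap.applyₗ l ∘ₗ (formEquiv (O 𝒜) L).toLinearMap ∘ₗ Δ) ?_ ?_ hω
  · simp [Δ, SHLieAlgebra.Q_one, J_one]
  · intro i d x hx
    refine ⟨((-1 : K) ^ (-m i)) • P.res (CSym.ι _ (b.coord i)), ?_, ?_⟩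
    · rw [map_smul, res, pullback, CSym.map_ι]
      simp [CSym.ι]
    · simp only [LinearMap.comp_apply, LinearEquiv.coe_coe, LinearMap.applyₗ_apply_apply]
      rw [hmul (coord_mem_dual_deg hb i) hx, map_smul, LinearMap.smul_apply, formEquiv_smul,
        smul_mul_assoc]

/-- Flatness is $Q_L^2 = 0$ seen through $J$: by `J_Q`, applying $Q_A + D^{L^\vee}$ to $J(Q_L\xi)$
gives $J(Q_L^2\xi)$. -/
theorem connection_ambientD (n : ℤ) (ξ : Module.Dual K L) (hξ : ξ ∈ (Grading.dual ℒ).deg n) :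
    connection P.small.Q P.ambientD (P.ambientD ξ) = 0 := by
  change connection P.small.Q P.ambientD (P.J (P.big.Q (CSym.ι _ ξ))) = 0
  rw [← P.J_Q (P.big.degree_one _ _ (CSym.ι_mem_deg hξ)), P.big.square_zero, map_zero]

variable (M : SHLieModule P.small ℰ)

theorem ambientComplex_isComplex : (P.ambientComplex M).IsComplex where
  d_mem _ _ hx := connection_mem_deg P.small (gF := (Grading.dual ℒ).tensor (Grading.endo ℰ))
    (fun _ _ hf => tensorD_mem_deg P.ambientD_mem_deg
      (fun _ _ hφ => endD_mem_deg M.degree_one hφ) hf) hx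
  d_d _ _ hx := connection_connection P.small (gF := (Grading.dual ℒ).tensor (Grading.endo ℰ))
    (fun _ _ hf => connection_tensorD P.small P.ambientD_mem_deg
      (fun _ _ hφ => endD_mem_deg M.degree_one hφ) P.connection_ambientD
      (fun _ _ hφ => connection_endD_endD P.small M.degree_one M.flat hφ) hf) hx

/-- The element `(J ⊗ 1)(D)` of `𝒪(A) ⊗ L^∨ ⊗ End(E)` for a connection form `D`. -/
noncomputable def jetForm (N : ConnectionForm ℒ ℰ) :
    O 𝒜 ⊗[K] (Module.Dual K L ⊗[K] Module.End K E) :=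
  TensorProduct.assoc K _ _ _ (P.J.rTensor (Module.End K E) N.D)

theorem jetForm_mem_deg (N : ConnectionForm ℒ ℰ) :
    P.jetForm N ∈ (P.ambientComplex M).deg 1 :=
  Grading.assoc_mem_deg _ _ _ (Grading.rTensor_mem_deg (CSym.grading (Grading.dual ℒ))
    (Grading.endo ℰ) ((CSym.grading (Grading.dual 𝒜)).tensor (Grading.dual ℒ))
    (fun _ _ hx => P.J_mem_deg hx) N.degree_one)

/-- `(J ⊗ 1)(R^∇)` is the differential of `(J ⊗ 1)(D^{L,E})`. -/
theorem curvatureForm_eq_d (N : ConnectionForm ℒ ℰ) (hN : P.Extends M N) :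
    P.curvatureForm N = (P.ambientComplex M).d (P.jetForm N) := by
  -- With $D = \sum_t \beta_t\otimes\varphi_t$, where $|\beta_t| = i_t$ and $|\varphi_t| = 1 - i_t$,
  -- the identity splits into a part linear in $D$, settled by `J_Q`, and a part indexed by pairs
  -- $(s,t)$.
  obtain ⟨k, β, φ, i, hβ, hφ, hD⟩ := Grading.exists_sum_tmul _ _ N.degree_one
  have hM : M.D = ∑ t, P.res (β t) ⊗ₜ[K] φ t := by
    rw [← show _ = M.D from hN, hD, map_sum]; rfl
  -- In the $(s,t)$ term of $D\circ D$, `c` is the contribution in which $J$ differentiates the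
  -- second form and `c'` the one in which it differentiates the first.
  let c (s t : Fin k) : O 𝒜 ⊗[K] (Module.Dual K L ⊗[K] Module.End K E) :=
    P.res (β s) • TensorProduct.assoc K _ _ _ (P.J (β t) ⊗ₜ (φ s * φ t))
  let c' (s t : Fin k) : O 𝒜 ⊗[K] (Module.Dual K L ⊗[K] Module.End K E) :=
    P.res (β t) • TensorProduct.assoc K _ _ _ (P.J (β s) ⊗ₜ (φ s * φ t))
  have hmul (s t : Fin k) : TensorProduct.assoc K _ _ _ (P.J.rTensor (Module.End K E)
      (gradedMulHom ℰ (β s ⊗ₜ φ s) (β t ⊗ₜ φ t))) =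
      ((-1 : K) ^ (i t + i t * i s)) • c s t + ((-1 : K) ^ i t) • c' s t := by
    rw [gradedMulHom_tmul (hφ s) (hβ t), map_smul, map_smul, LinearMap.rTensor_tmul,
      P.J_mul (hβ s) (hβ t), TensorProduct.add_tmul, map_add,
      ← TensorProduct.smul_tmul' ((-1 : K) ^ _),
      map_smul (TensorProduct.assoc K (O 𝒜) _ _) ((-1 : K) ^ _), assoc_smul_tmul, assoc_smul_tmul, smul_add]
    rw [smul_smul, neg_one_zpow_mul,
      neg_one_zpow_congr (a := (1 - i s) * i t) (b := i t + i t * i s) (by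
        rw [← Int.even_sub]; exact ⟨-(i s * i t), by ring⟩),
      neg_one_zpow_congr (a := (1 - i s) * i t + i s * i t) (b := i t) (by ring_nf)]
  -- The two halves of the commutator correspond to the two halves of the Leibniz rule for $J$. In
  -- the second half the roles of `s` and `t` are exchanged, and the minus sign of the commutator is
  -- absorbed by the exponent $i_s + 1$.
  have hbr (s t : Fin k) : ((-1 : K) ^ i t) • formMul (Grading.dual ℒ) (P.J (β t))
      (P.res (β s) ⊗ₜ gradedCommutator ℰ (φ t) (φ s)) =
      ((-1 : K) ^ (i t + i t * i s)) • c s t + ((-1 : K) ^ i s) • c' t s := by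
    rw [formMul_tmul (P.J_mem_deg (hβ t)) (P.res_mem_deg (hβ s)),
      gradedCommutator_apply ℰ (hφ t) (hφ s), TensorProduct.tmul_sub, TensorProduct.tmul_smul,
      map_sub, map_smul, smul_sub, smul_comm (P.res (β s)), smul_sub,
      smul_sub, sub_eq_add_neg]
    rw [smul_smul, smul_smul, smul_smul, neg_one_zpow_mul, neg_one_zpow_mul,
      neg_one_zpow_congr (a := i t + i t * i s + (1 - i t) * (1 - i s)) (b := i s + 1) (by
        rw [← Int.even_sub]; exact ⟨i t * i s - i s, by ring⟩)]
    congr 1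
    rw [zpow_add_one₀ (by simp), mul_neg_one]
    exact (congrArg Neg.neg (neg_smul _ _)).trans (neg_neg _)
  clear_value c c'
  have hterm (t : Fin k) : (P.ambientComplex M).d
      (TensorProduct.assoc K _ _ _ (P.J (β t) ⊗ₜ[K] φ t)) =
      TensorProduct.assoc K _ _ _ (P.J (P.big.Q (β t)) ⊗ₜ[K] φ t) +
      ∑ s, (((-1 : K) ^ (i t + i t * i s)) • c s t + ((-1 : K) ^ i s) • c' t s) := by
    have h1 := Grading.tmul_mem (CSym.grading (Grading.dual 𝒜)) (Grading.endo ℰ) CSym.one_mem_deg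
      (hφ t) (zero_add _)
    rw [← formMul_one_tmul (P.J_mem_deg (hβ t))]
    refine (connection_formMul P.small P.ambientD_mem_deg
      (fun _ _ hφ => endD_mem_deg M.degree_one hφ) (P.J_mem_deg (hβ t)) h1).trans ?_
    rw [← P.J_Q (hβ t), formMul_one_tmul (P.J_mem_deg (P.big.degree_one _ _ (hβ t))),
      connection_one_tmul, endD_apply, hM, map_sum, map_sum, Finset.smul_sum]
    congr 1
    exact Finset.sum_congr rfl fun s _ => hbr s t
  rw [curvatureForm, curvature, jetForm, hD, ← gradedMulHom_apply]
  simp only [map_sum, LinearMap.sum_apply, map_add, LinearMap.rTensor_tmul, hmul, hterm,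
    Finset.sum_add_distrib]
  -- What remains differs only in the order of one double summation.
  congr 2
  exact Finset.sum_comm

end SHLiePair

/-! ### Graded retractions and splittings -/

section Retraction

variable {K : Type*} [Field K] {L A : Type*} [AddCommGroup L] [Module K L]
  [AddCommGroup A] [Module K A]

/-- An injective linear map of degree `0` has a left inverse of degree `0`. -/
theorem exists_graded_retraction (ℒ : ℤ → Submodule K L) [DirectSum.Decomposition ℒ]
    (𝒜 : ℤ → Submodule K A) [DirectSum.Decomposition 𝒜] (j : A →ₗ[K] L)
    (hj : Function.Injective j) (hdeg : ∀ n, ∀ a ∈ 𝒜 n, j a ∈ ℒ n) :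
    ∃ s : L →ₗ[K] A, (∀ n, ∀ l ∈ ℒ n, s l ∈ 𝒜 n) ∧ s ∘ₗ j = LinearMap.id := by
  -- Left inverses exist degree by degree over a field; their direct sum has degree $0$.
  have hex (n : ℤ) : ∃ s : ℒ n →ₗ[K] 𝒜 n, s ∘ₗ j.restrict (hdeg n) = LinearMap.id := by
    refine LinearMap.exists_leftInverse_of_injective _ (LinearMap.ker_eq_bot.mpr fun a b h => ?_)
    exact Subtype.ext (hj (congrArg Subtype.val h))
  choose s hs using hex
  let σ : L →ₗ[K] A := DirectSum.toModule K ℤ A (fun n => (𝒜 n).subtype ∘ₗ s n) ∘ₗ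
    (DirectSum.decomposeLinearEquiv ℒ).toLinearMap
  have hσ (n : ℤ) (l : ℒ n) : σ l = s n l := by
    simp only [σ, LinearMap.comp_apply, LinearEquiv.coe_coe,
      DirectSum.decomposeLinearEquiv_apply, DirectSum.decompose_coe]
    erw [DirectSum.toModule_lof]
    rfl
  refine ⟨σ, fun n l hl => ?_, linearMap_ext_of_homogeneous 𝒜 fun n a ha => ?_⟩
  · rw [hσ n ⟨l, hl⟩]; exact (s n _).2
  · rw [LinearMap.comp_apply, hσ n ⟨j a, hdeg n a ha⟩]
    exact congrArg Subtype.val (LinearMap.congr_fun (hs n) ⟨a, ha⟩)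

/-- A splitting survives tensoring on both sides. It yields exactness with an explicit preimage,
whose degree can be controlled. -/
theorem lTensor_rTensor_comp_add {X Y Z : Type*} (R T : Type*) [AddCommMonoid R] [Module K R]
    [AddCommMonoid T] [Module K T] [AddCommMonoid X] [Module K X] [AddCommMonoid Y] [Module K Y]
    [AddCommMonoid Z] [Module K Z] (i : X →ₗ[K] Y) (r : Y →ₗ[K] X) (q : Z →ₗ[K] Y)
    (p : Y →ₗ[K] Z) (h : i ∘ₗ r + q ∘ₗ p = LinearMap.id) (y : R ⊗[K] (Y ⊗[K] T)) :
    (i.rTensor T).lTensor R ((r.rTensor T).lTensor R y) +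
      (q.rTensor T).lTensor R ((p.rTensor T).lTensor R y) = y := by
  rw [← LinearMap.comp_apply, ← LinearMap.comp_apply, ← LinearMap.lTensor_comp,
    ← LinearMap.lTensor_comp, ← LinearMap.rTensor_comp, ← LinearMap.rTensor_comp,
    ← LinearMap.add_apply, ← LinearMap.lTensor_add, ← LinearMap.rTensor_add, h,
    LinearMap.rTensor_id, LinearMap.lTensor_id, LinearMap.id_apply]

end Retraction

/-! ### Functor laws for symmetric algebras -/

section MapLaws

variable {K : Type*} [Field K] {W W' W'' : Type*} [AddCommGroup W] [Module K W]
  [AddCommGroup W'] [Module K W'] [AddCommGroup W''] [Module K W'']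
  {g : Grading K W} {g' : Grading K W'} {g'' : Grading K W''}

/-- The identity enters as an equation so that the lemma also applies to maps such as `j.dualMap ∘ₗ
s.dualMap`, which are not syntactically the identity. -/
theorem Sym.map_eq_self {f : W →ₗ[K] W} (hf : ∀ n, ∀ x ∈ g.deg n, f x ∈ g.deg n)
    (hid : f = LinearMap.id) (x : Sym g) : Sym.map f hf x = x := by
  subst hid
  induction x using Sym.induction with
  | one => simp
  | smul r x hx => simp [hx]
  | add x y hx hy => simp [hx, hy]
  | ι_mul w x hx => simp [hx]

theorem CSym.map_eq_self {f : W →ₗ[K] W} (hf : ∀ n, ∀ x ∈ g.deg n, f x ∈ g.deg n)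
    (hid : f = LinearMap.id) (x : CSym g) : CSym.map f hf x = x := by
  ext n
  rw [CSym.coeff_map, Sym.map_eq_self hf hid]

theorem Sym.map_map (f : W →ₗ[K] W') (hf : ∀ n, ∀ x ∈ g.deg n, f x ∈ g'.deg n)
    (f' : W' →ₗ[K] W'') (hf' : ∀ n, ∀ x ∈ g'.deg n, f' x ∈ g''.deg n) (x : Sym g) :
    Sym.map f' hf' (Sym.map f hf x) =
      Sym.map (f' ∘ₗ f) (fun n x hx => hf' n _ (hf n x hx)) x := by
  induction x using Sym.induction with
  | one => simp
  | smul r x hx => simp [hx]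
  | add x y hx hy => simp [hx, hy]
  | ι_mul w x hx => simp [hx]

theorem CSym.map_map (f : W →ₗ[K] W') (hf : ∀ n, ∀ x ∈ g.deg n, f x ∈ g'.deg n)
    (f' : W' →ₗ[K] W'') (hf' : ∀ n, ∀ x ∈ g'.deg n, f' x ∈ g''.deg n) (x : CSym g) :
    CSym.map f' hf' (CSym.map f hf x) =
      CSym.map (f' ∘ₗ f) (fun n x hx => hf' n _ (hf n x hx)) x := by
  ext n
  rw [CSym.coeff_map, CSym.coeff_map, CSym.coeff_map, Sym.map_map]

end MapLaws

/-! ### The short exact sequence and the connecting map -/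

namespace SHLiePair

variable {K : Type*} [Field K] [CharZero K]
  {L A E : Type*} [AddCommGroup L] [Module K L] [FiniteDimensional K L]
  [AddCommGroup A] [Module K A] [FiniteDimensional K A] [AddCommGroup E] [Module K E]
  {ℒ : ℤ → Submodule K L} [DirectSum.Decomposition ℒ]
  {𝒜 : ℤ → Submodule K A} [DirectSum.Decomposition 𝒜]
  {ℰ : ℤ → Submodule K E} [DirectSum.Decomposition ℰ]
  (P : SHLiePair ℒ 𝒜)

set_option linter.unusedSectionVars false

theorem lTensor_ambientD (ξ : Module.Dual K L) :
    P.j.dualMap.lTensor (O 𝒜) (P.ambientD ξ) = P.coadjointD (P.j.dualMap ξ) := by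
  rw [ambientD, LinearMap.comp_apply, lTensor_J, LinearMap.comp_apply, res_Q]
  have : P.res (CSym.ι _ ξ) = CSym.ι _ (P.j.dualMap ξ) := CSym.map_ι _ _ ξ
  rw [this]
  rfl

/-- An SH Lie algebra as a subalgebra of itself. -/
noncomputable abbrev refl (S : SHLieAlgebra 𝒜) : SHLiePair 𝒜 𝒜 where
  big := S
  small := S
  j := LinearMap.id
  j_injective := Function.injective_id
  j_degree_zero _ _ ha := ha
  subalgebra ω := by
    rw [pullback, CSym.map_eq_self _ LinearMap.dualMap_id, CSym.map_eq_self _ LinearMap.dualMap_id]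

theorem refl_J (S : SHLieAlgebra 𝒜) : (refl S).J = deRham 𝒜 := by
  have h : (refl S).res.toLinearMap = LinearMap.id :=
    LinearMap.ext fun x => CSym.map_eq_self _ LinearMap.dualMap_id x
  rw [J, h, LinearMap.rTensor_id, LinearMap.id_comp]

variable (M : SHLieModule P.small ℰ)

/-- Results about the $L^\vee$-complex of an arbitrary pair now apply to the $A^\vee$-complex by
taking $L = A$. -/
theorem refl_ambientComplex : (refl P.small).ambientComplex M = P.coadjointComplex M := by
  have h : (refl P.small).ambientD = P.coadjointD := by
    rw [ambientD, refl_J]; rfl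
  change (refl P.small).ceComplex M (Grading.dual 𝒜) (refl P.small).ambientD = _
  rw [h]
  rfl

/-- Functoriality of the Chevalley–Eilenberg complex in the module. -/
theorem ceComplex_d_map {F F' : Type*} [AddCommGroup F] [Module K F] [AddCommGroup F'] [Module K F']
    {gF : Grading K F} {gF' : Grading K F'} {DF : F →ₗ[K] O 𝒜 ⊗[K] F}
    {DF' : F' →ₗ[K] O 𝒜 ⊗[K] F'} (p : F →ₗ[K] F') (hp : ∀ f, p.lTensor (O 𝒜) (DF f) = DF' (p f))
    (hs : ∀ f, p (gF.sgn f) = gF'.sgn (p f)) (x : O 𝒜 ⊗[K] (F ⊗[K] Module.End K E)) :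
    (p.rTensor (Module.End K E)).lTensor (O 𝒜) ((P.ceComplex M gF DF).d x) =
      (P.ceComplex M gF' DF').d ((p.rTensor (Module.End K E)).lTensor (O 𝒜) x) :=
  connection_lTensor P.small.Q (tensorD_rTensor _ hp hs) x

theorem proj_d (x : O 𝒜 ⊗[K] (Module.Dual K L ⊗[K] Module.End K E)) :
    P.proj E ((P.ambientComplex M).d x) = (P.coadjointComplex M).d (P.proj E x) :=
  P.ceComplex_d_map M P.j.dualMap P.lTensor_ambientD (dualMap_sgn P.j P.j_degree_zero) x

theorem incl_d (x : O 𝒜 ⊗[K] (P.perp ⊗[K] Module.End K E)) :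
    P.incl E ((P.perpComplex M).d x) = (P.ambientComplex M).d (P.incl E x) := by
  have hs (ξ : P.perp) : P.perp.subtype (P.perpGrading.sgn ξ) =
      (Grading.dual ℒ).sgn (P.perp.subtype ξ) := rfl
  have hD (ξ : P.perp) : P.perp.subtype.lTensor (O 𝒜) (P.perpD ξ) =
      P.ambientD (P.perp.subtype ξ) := P.lTensor_perpD ξ
  exact P.ceComplex_d_map M (gF := P.perpGrading) (gF' := Grading.dual ℒ) (DF := P.perpD)
    (DF' := P.ambientD) P.perp.subtype hD hs x

theorem incl_injective : Function.Injective (P.incl E) :=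
  Module.Flat.lTensor_preserves_injective_linearMap _
    (Module.Flat.rTensor_preserves_injective_linearMap _ P.perp.injective_subtype)

theorem lTensor_rTensor_mem_deg {F F' : Type*} [AddCommGroup F] [Module K F] [AddCommGroup F']
    [Module K F'] (gF : Grading K F) (gF' : Grading K F') {f : F →ₗ[K] F'}
    (hf : ∀ n, ∀ x ∈ gF.deg n, f x ∈ gF'.deg n) {n : ℤ}
    {x : O 𝒜 ⊗[K] (F ⊗[K] Module.End K E)}
    (hx : x ∈ ((CSym.grading (Grading.dual 𝒜)).tensor (gF.tensor (Grading.endo ℰ))).deg n) :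
    (f.rTensor (Module.End K E)).lTensor (O 𝒜) x ∈
      ((CSym.grading (Grading.dual 𝒜)).tensor (gF'.tensor (Grading.endo ℰ))).deg n :=
  Grading.lTensor_mem_deg _ _ _ (fun _ _ hy => Grading.rTensor_mem_deg _ _ _ hf hy) hx

theorem incl_mem_deg {n : ℤ} {x : O 𝒜 ⊗[K] (P.perp ⊗[K] Module.End K E)}
    (hx : x ∈ (P.perpComplex M).deg n) : P.incl E x ∈ (P.ambientComplex M).deg n :=
  lTensor_rTensor_mem_deg P.perpGrading (Grading.dual ℒ) (fun _ _ hξ => hξ) hx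

theorem proj_mem_deg {n : ℤ} {x : O 𝒜 ⊗[K] (Module.Dual K L ⊗[K] Module.End K E)}
    (hx : x ∈ (P.ambientComplex M).deg n) : P.proj E x ∈ (P.coadjointComplex M).deg n :=
  lTensor_rTensor_mem_deg (Grading.dual ℒ) (Grading.dual 𝒜) (dualMap_mem_deg P.j P.j_degree_zero) hx

theorem proj_incl (x : O 𝒜 ⊗[K] (P.perp ⊗[K] Module.End K E)) : P.proj E (P.incl E x) = 0 := by
  have h : P.j.dualMap ∘ₗ P.perp.subtype = 0 := LinearMap.ext fun ξ => ξ.2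
  rw [proj, incl, ← LinearMap.comp_apply, ← LinearMap.lTensor_comp, ← LinearMap.rTensor_comp, h]
  simp

/-- A retraction of `j` of degree `0` splits the sequence of graded spaces. -/
theorem exists_incl_eq {s : L →ₗ[K] A} (hs : ∀ n, ∀ l ∈ ℒ n, s l ∈ 𝒜 n)
    (hsj : s ∘ₗ P.j = LinearMap.id) {n : ℤ}
    {y : O 𝒜 ⊗[K] (Module.Dual K L ⊗[K] Module.End K E)}
    (hy : y ∈ (P.ambientComplex M).deg n) (hp : P.proj E y = 0) :
    ∃ x ∈ (P.perpComplex M).deg n, P.incl E x = y := by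
  have hsec (ξ : Module.Dual K A) : P.j.dualMap (s.dualMap ξ) = ξ :=
    LinearMap.ext fun a => congrArg ξ (LinearMap.congr_fun hsj a)
  -- $\xi\mapsto \xi - s^\vee j^\vee\xi$ is a projection of degree $0$ onto $A^\perp$. Applied to
  -- `y` it gives a preimage in the same degree, which exactness of the ungraded sequence alone
  -- would not provide.
  let ρ : Module.Dual K L →ₗ[K] P.perp :=
    (LinearMap.id - s.dualMap ∘ₗ P.j.dualMap).codRestrict P.perp fun ξ => by
      change P.j.dualMap (ξ - s.dualMap (P.j.dualMap ξ)) = 0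
      rw [map_sub, hsec, sub_self]
  refine ⟨(ρ.rTensor (Module.End K E)).lTensor (O 𝒜) y, lTensor_rTensor_mem_deg (Grading.dual ℒ)
    P.perpGrading (fun n ξ hξ => ?_) hy, ?_⟩
  · exact sub_mem hξ (dualMap_mem_deg s hs n _ (dualMap_mem_deg P.j P.j_degree_zero n ξ hξ))
  · have hρ : P.perp.subtype ∘ₗ ρ + s.dualMap ∘ₗ P.j.dualMap = LinearMap.id :=
      LinearMap.ext fun ξ => sub_add_cancel ξ (s.dualMap (P.j.dualMap ξ))
    have h := lTensor_rTensor_comp_add (O 𝒜) (Module.End K E) (P.perp.subtype) ρ s.dualMap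
      P.j.dualMap hρ y
    change P.incl E _ + (s.dualMap.rTensor (Module.End K E)).lTensor (O 𝒜) (P.proj E y) = y at h
    rwa [hp, map_zero, add_zero] at h

theorem exists_proj_eq {s : L →ₗ[K] A} (hs : ∀ n, ∀ l ∈ ℒ n, s l ∈ 𝒜 n)
    (hsj : s ∘ₗ P.j = LinearMap.id) {n : ℤ}
    {z : O 𝒜 ⊗[K] (Module.Dual K A ⊗[K] Module.End K E)}
    (hz : z ∈ (P.coadjointComplex M).deg n) : ∃ y ∈ (P.ambientComplex M).deg n, P.proj E y = z := by
  have hsec : P.j.dualMap ∘ₗ s.dualMap = LinearMap.id :=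
    LinearMap.ext fun ξ => LinearMap.ext fun a => congrArg ξ (LinearMap.congr_fun hsj a)
  refine ⟨(s.dualMap.rTensor (Module.End K E)).lTensor (O 𝒜) z,
    lTensor_rTensor_mem_deg (Grading.dual 𝒜) (Grading.dual ℒ) (dualMap_mem_deg s hs) hz, ?_⟩
  rw [proj, ← LinearMap.comp_apply, ← LinearMap.lTensor_comp, ← LinearMap.rTensor_comp, hsec]
  simp

theorem shortExact : Cochains.ShortExact (P.perpComplex M) (P.ambientComplex M)
    (P.coadjointComplex M) (P.incl E) (P.proj E) := by
  obtain ⟨s, hs, hsj⟩ := exists_graded_retraction ℒ 𝒜 P.j P.j_injective P.j_degree_zero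
  have h2 := P.ambientComplex_isComplex M
  exact
    { complex₁ :=
        { d_mem := fun n x hx => by
            -- The degree of $dx$ is read off in the ambient complex: its image there has degree
            -- $n+1$ and projects to zero, so it has a preimage of that degree, and by injectivity
            -- this preimage is $dx$.
            obtain ⟨x', hx', h⟩ := P.exists_incl_eq M hs hsj (h2.d_mem n _ (P.incl_mem_deg M hx))
              (by rw [← incl_d, proj_incl])
            rwa [← P.incl_injective (h.trans (P.incl_d M x).symm)]
          d_d := fun n x hx => P.incl_injective (by
            rw [incl_d, incl_d, h2.d_d n _ (P.incl_mem_deg M hx), map_zero]) }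
      complex₂ := h2
      complex₃ := P.refl_ambientComplex M ▸ (refl P.small).ambientComplex_isComplex M
      i_mem := fun _ _ hx => P.incl_mem_deg M hx
      p_mem := fun _ _ hy => P.proj_mem_deg M hy
      i_d := fun _ x _ => P.incl_d M x
      p_d := fun _ y _ => P.proj_d M y
      injective := fun _ x _ hx => P.incl_injective (hx.trans (map_zero _).symm)
      p_i := fun _ x _ => P.proj_incl x
      exact := fun _ _ hy hp => P.exists_incl_eq M hs hsj hy hp
      surjective := fun _ _ hz => P.exists_proj_eq M hs hsj hz }

theorem refl_jetForm : (refl P.small).jetForm M.toConnectionForm = P.deRhamForm M := by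
  rw [jetForm, refl_J, deRhamForm]

/-- This is the key identity for the pair $(A,A)$: the element is the jet form of the $A$-module
regarded as a connection, so its differential is the image of the curvature, which is zero. -/
theorem deRhamForm_mem_cocycles : P.deRhamForm M ∈ (P.coadjointComplex M).cocycles 1 := by
  rw [← refl_jetForm, ← refl_ambientComplex]
  refine ⟨(refl P.small).jetForm_mem_deg M _, ?_⟩
  have hext : (refl P.small).Extends M M.toConnectionForm := by
    have h : (refl P.small).res.toLinearMap = LinearMap.id :=
      LinearMap.ext fun x => CSym.map_eq_self _ LinearMap.dualMap_id x
    change (refl P.small).res.toLinearMap.rTensor _ M.D = M.D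
    rw [h, LinearMap.rTensor_id, LinearMap.id_apply]
  change ((refl P.small).ambientComplex M).d _ = 0
  rw [← (refl P.small).curvatureForm_eq_d M _ hext, curvatureForm]
  change TensorProduct.assoc K _ _ _ (LinearMap.rTensor _ _ (curvature ℰ P.small.Q M.D)) = 0
  rw [M.flat, map_zero, map_zero]

/-- The jet form is the lift on which the connecting map is evaluated. The reason is $(1\otimes
j^\vee)J = I^A j^\vee$ together with $j^\vee(D^{L,E}) = D^{A,E}$. -/
theorem proj_jetForm (N : ConnectionForm ℒ ℰ) (hN : P.Extends M N) :
    P.proj E (P.jetForm N) = P.deRhamForm M := by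
  have hassoc (x : O 𝒜 ⊗[K] Module.Dual K L) (φ : Module.End K E) :
      P.proj E (TensorProduct.assoc K _ _ _ (x ⊗ₜ φ)) =
        TensorProduct.assoc K _ _ _ (P.j.dualMap.lTensor (O 𝒜) x ⊗ₜ φ) := by
    induction x with
    | zero => simp
    | add x y hx hy => simp only [TensorProduct.add_tmul, map_add, hx, hy]
    | tmul a ξ => rfl
  rw [jetForm, deRhamForm, ← show _ = M.D from hN]
  induction N.D with
  | zero => simp
  | add x y hx hy => simp only [map_add, hx, hy]
  | tmul ω φ =>
    rw [LinearMap.rTensor_tmul, hassoc, lTensor_J]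
    rfl

/-- An `A`-module structure extends to an `L`-connection. -/
theorem exists_extends : ∃ N : ConnectionForm ℒ ℰ, P.Extends M N := by
  obtain ⟨s, hs, hsj⟩ := exists_graded_retraction ℒ 𝒜 P.j P.j_injective P.j_degree_zero
  -- The connection form is pulled back along the retraction `s`. No compatibility of `s` with the
  -- homological vector fields is needed, as a connection need not be flat; restriction recovers
  -- `M.D` because $s\circ j = 1$.
  refine ⟨⟨(pullback s hs).toLinearMap.rTensor _ M.D, Grading.rTensor_mem_deg _ _ _
    (fun _ _ hx => CSym.map_mem_deg _ _ hx) M.degree_one⟩, ?_⟩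
  have hid : P.j.dualMap ∘ₗ s.dualMap = LinearMap.id :=
    LinearMap.ext fun ξ => LinearMap.ext fun a => congrArg ξ (LinearMap.congr_fun hsj a)
  have h : P.res.toLinearMap ∘ₗ (pullback s hs).toLinearMap = LinearMap.id :=
    LinearMap.ext fun x => (CSym.map_map _ _ _ _ x).trans (CSym.map_eq_self _ hid x)
  rw [Extends, ← LinearMap.comp_apply, ← LinearMap.rTensor_comp, h, LinearMap.rTensor_id,
    LinearMap.id_apply]

/-- The connecting map sends the class of `(I^A ⊗ 1)(D^{A,E})` to the Atiyah class. -/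
theorem isAtiyahClassOf_delta (hses : Cochains.ShortExact (P.perpComplex M) (P.ambientComplex M)
    (P.coadjointComplex M) (P.incl E) (P.proj E))
    (hcocycle : P.deRhamForm M ∈ (P.coadjointComplex M).cocycles 1) (N : ConnectionForm ℒ ℰ)
    (hN : P.Extends M N) :
    P.IsAtiyahClassOf M N
      (hses.delta 1 ((P.coadjointComplex M).cls 1 (P.deRhamForm M) hcocycle)) := by
  have hy := P.jetForm_mem_deg M N
  have hp := P.proj_jetForm M N hN
  have hcurv := P.curvatureForm_eq_d M N hN
  -- The differential of the jet form projects to the differential of a cocycle, hence to zero, and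
  -- so comes from the $A^\perp$-complex.
  obtain ⟨α, hα, hαd⟩ := hses.exact (1 + 1) _ (hses.complex₂.d_mem 1 _ hy) (by
    rw [hses.p_d 1 _ hy, hp]; exact hcocycle.2)
  have hαc : α ∈ (P.perpComplex M).cocycles (1 + 1) := by
    refine ⟨hα, P.incl_injective ?_⟩
    rw [incl_d, hαd, hses.complex₂.d_d 1 _ hy, map_zero]
  exact ⟨α, hαc, hαd.trans hcurv.symm, hses.delta_cls hcocycle hαc hy hp hαd⟩

end SHLiePair

end SHLie

theorem theorem2p12 {K : Type*} [Field K] [CharZero K]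
    {L A E : Type*} [AddCommGroup L] [Module K L] [FiniteDimensional K L]
    [AddCommGroup A] [Module K A] [FiniteDimensional K A] [AddCommGroup E] [Module K E]
    (ℒ : ℤ → Submodule K L) [DirectSum.Decomposition ℒ]
    (𝒜 : ℤ → Submodule K A) [DirectSum.Decomposition 𝒜]
    (ℰ : ℤ → Submodule K E) [DirectSum.Decomposition ℰ]
    (P : SHLie.SHLiePair ℒ 𝒜) (M : SHLie.SHLieModule P.small ℰ) :
    ∃ (hses : SHLie.Cochains.ShortExact (P.perpComplex M) (P.ambientComplex M)
        (P.coadjointComplex M) (P.incl E) (P.proj E))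
      (hcocycle : P.deRhamForm M ∈ (P.coadjointComplex M).cocycles 1),
      (∃ N : SHLie.ConnectionForm ℒ ℰ, P.Extends M N) ∧
      ∀ N : SHLie.ConnectionForm ℒ ℰ, P.Extends M N →
        P.IsAtiyahClassOf M N
          (hses.delta 1 ((P.coadjointComplex M).cls 1 (P.deRhamForm M) hcocycle)) := by
  exact ⟨P.shortExact M, P.deRhamForm_mem_cocycles M, P.exists_extends M,
    fun N hN => P.isAtiyahClassOf_delta M _ _ N hN⟩
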